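/- Let $\Sigma$ be a finite alphabet. A word $w$ over $\{1,2\}\times\Sigma$ synchronizes the pair $[\![w]\!]=(w_1,w_2)\in\Sigma^*\times\Sigma^*$, where $w_1$ (input) and $w_2$ (output) are obtained by keeping the letters of $w$ annotated with $1$ and with $2$, respectively; for $L\subseteq(\{1,2\}\times\Sigma)^*$ put $[\![L]\!]=\{[\![w]\!] : w\in L\}$. A shift of $w$ is a position $1\le i<|w|$ at which the annotations of the $i$-th and the $(i+1)$-st letter differ; $L$ has finite shift if the number of shifts of its words is bounded. A uniformization of a relation $R\subseteq \Sigma^*\times\Sigma^*$ is a function $f\colon\mathrm{dom}(R)\to\Sigma^*$ with $(u,f(u))\in R$ for all $u\in\mathrm{dom}(R)$, identified with its graph. A sequential DFA over $\{1,2\}\times\Sigma$ is a finite automaton with one initial state and at most one successor for each state and letter, such that every state has either an outgoing transition labeled in $\{1\}\times\Sigma$ or one labeled in $\{2\}\times\Sigma$ but not both, and every state with an outgoing transition labeled in $\{2\}\times\Sigma$ has exactly one outgoing transition. **Theorem.** The following problem (the resynchronized uniformization problem for sources with finite shift) is decidable. Given a finite alphabet $\Sigma$ and nondeterministic finite automata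 that recognize a source language $S\subseteq(\{1,2\}\times\Sigma)^*$ with finite shift and an arbitrary target language $T\subseteq(\{1,2\}\times\Sigma)^*$, is there a language $U\subseteq T$ recognized by a sequential DFA such that $[\![U]\!]$ is a uniformization of $[\![S]\!]$? That is, there is an algorithm that halts on all pairs of automata and answers this question correctly whenever $S$ has finite shift. -/

import Mathlib

namespace Sync

/-! ### Synchronizations of pairs of words

Tape `0 : Fin 2` is the input (annotation 1), tape `1 : Fin 2` is the output (annotation 2). -/

/-- Letters over `A` annotated with the tape they belong to. -/
abbrev Letter (A : Type) : Type := Fin 2 × A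

/-- The word on tape `c` obtained from `w` by erasing the letters of the other tape. -/
def proj {A : Type} (c : Fin 2) (w : List (Letter A)) : List A :=
  w.filterMap fun x => if x.1 = c then some x.2 else none

/-- The pair of (input, output) words synchronized by `w`. -/
def pairOf {A : Type} (w : List (Letter A)) : List A × List A :=
  (proj 0 w, proj 1 w)

/-- The relation `{⟦w⟧ | w ∈ S}` denoted by a language of synchronizations. -/
def rel {A : Type} (S : Language (Letter A)) : SetRel (List A) (List A) :=
  {p | ∃ w ∈ S, pairOf w = p}

/-- The number of positions `i` with `1 ≤ i < |w|` and `w[i] ≠ w[i+1]`. -/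
def wordShift (w : List (Fin 2)) : ℕ :=
  (w.zip w.tail).countP fun p => p.1 ≠ p.2

/-- The supremum in `ℕ ∪ {∞}` of the number of shifts of the words of `S`, where the shifts of a
word over the annotated alphabet are those of its sequence of annotations. -/
noncomputable def shift {A : Type} (S : Language (Letter A)) : ℕ∞ :=
  ⨆ w ∈ S, (wordShift (w.map Prod.fst) : ℕ∞)

/-! ### Uniformizations -/

/-- `F` is (the graph of) a uniformization of `R`: a function that is defined exactly on the domain
of `R` and selects for each element of the domain an image that is in relation with it. -/
structure IsUniformization {X Y : Type} (F R : SetRel X Y) : Prop where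
  subset : F ⊆ R
  dom_eq : F.dom = R.dom
  functional : ∀ x y z, (x, y) ∈ F → (x, z) ∈ F → y = z

/-! ### Sequential automata -/

/-- The states with an outgoing transition that is labeled by a letter of tape `c`. -/
def tapeStates {A Q : Type} (M : NFA (Letter A) Q) (c : Fin 2) : Set Q :=
  {p | ∃ a q, q ∈ M.step p (c, a)}

/-- Sequential automata: deterministic (one initial state, at most one successor per state and
letter), the input states and the output states partition the set of states, and every output
state has at most one outgoing transition. -/
structure IsSequential {A Q : Type} (M : NFA (Letter A) Q) : Prop where
  start : ∃ q, M.start = {q}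
  deterministic : ∀ q x, (M.step q x).Subsingleton
  partition : IsCompl (tapeStates M 0) (tapeStates M 1)
  output : ∀ q ∈ tapeStates M 1, ∀ x y p r, p ∈ M.step q x → r ∈ M.step q y → x = y ∧ p = r

/-- `U` is recognized by a finite sequential automaton. -/
def SequentiallyRecognizable {A : Type} (U : Language (Letter A)) : Prop :=
  ∃ (Q : Type) (_ : Finite Q) (M : NFA (Letter A) Q), IsSequential M ∧ M.accepts = U

/-- The question of the resynchronized uniformization problem for source `S` and target `T`:
is there a `T`-controlled uniformization of `S` by a sequential automaton? -/
def HasControlledUniformization {A : Type} (S T : Language (Letter A)) : Prop :=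
  ∃ U : Language (Letter A), U ≤ T ∧ SequentiallyRecognizable U ∧ IsUniformization (rel U) (rel S)

/-! ### Finite automata as inputs of algorithms -/

/-- A finite description of a nondeterministic automaton with states `0, …, numStates - 1` whose
letters are annotated natural numbers. -/
structure NFACode where
  numStates : ℕ
  start : ℕ
  transitions : List (ℕ × Letter ℕ × ℕ)
  final : List ℕ

/-- An `NFACode` is encoded as the tuple of its components. -/
def NFACode.equivTuple : NFACode ≃ ℕ × ℕ × List (ℕ × Letter ℕ × ℕ) × List ℕ where
  toFun c := (c.numStates, c.start, c.transitions, c.final)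
  invFun t := ⟨t.1, t.2.1, t.2.2.1, t.2.2.2⟩
  left_inv _ := rfl
  right_inv _ := rfl

instance : Primcodable NFACode := Primcodable.ofEquiv _ NFACode.equivTuple

/-- The automaton described by a code over the annotated version of the alphabet
`{0, …, k - 1}`; entries of the lists that are out of range are ignored. -/
def NFACode.toNFA (c : NFACode) (k : ℕ) : NFA (Letter (Fin k)) (Fin c.numStates) where
  step p x := {q | ((p : ℕ), (x.1, (x.2 : ℕ)), (q : ℕ)) ∈ c.transitions}
  start := {q | (q : ℕ) = c.start}
  accept := {q | (q : ℕ) ∈ c.final}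

/-- The regular language described by a code over the alphabet `{0, …, k - 1}`. -/
def NFACode.language (c : NFACode) (k : ℕ) : Language (Letter (Fin k)) :=
  (c.toNFA k).accepts

end Sync

/-! Two observations reduce the problem to a finite game. A sequential automaton is a strategy:
output states leave no choice and input states branch only on the next input letter, so runs with
prefix-comparable inputs are themselves prefix-comparable (`IsSequential.prefix_or_prefix`). Suppose
a finite deterministic automaton reads annotated words `w` and its state tells whether the input of
`w` lies in the domain of the source (`accD`) and whether `w` lies in the target with its pair in
the source relation (`accT`). Then a controlled uniformization exists iff the alphabet is nonempty
and the output player wins on these states. After each input letter this player must be able to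
write some `x` that makes the word acceptable, if the input may end here, and some further `y`
before the next letter is read (`hasControlledUniformization_iff`). A winning set yields a
positional strategy, hence a finite automaton.

Finite shift supplies the regularity of the condition that the pair of `w` is in the source
relation. If `S` has `n` states and finite shift, pumping bounds the shifts of its words by `2 * 2 ^
n` (`wordShift_lt_of_shift_lt_top`). An accepting path therefore splits into a fixed number of
alternating, possibly empty, input and output blocks. Once the states `σ` at the block boundaries
are guessed, the conditions on the input and on the output are independent regular conditions. So
the relation is a finite union of products of regular languages, and two components that each watch
one tape and share the guess recognize it along any `w` (`exists_run_finR`). Two more components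
treat the domain and the target.

For computability, all four components are placed on an initial segment of the natural numbers, and
sets of states and sets of such sets become bit sets. The statement that some winning set exists
then uses bounded quantifiers only, so it is primitive recursive in the codes (`PrimrecArena.wins`).
-/

namespace Sync

/-! ### Projections and annotated words -/

/-- The word `b` with all letters annotated by the tape `c`. -/
def tag {A : Type} (c : Fin 2) (b : List A) : List (Letter A) := b.map (Prod.mk c)

section Words
variable {A : Type}

@[simp] theorem proj_nil (c : Fin 2) : proj c ([] : List (Letter A)) = [] := rfl

@[simp] theorem proj_append (c : Fin 2) (u v : List (Letter A)) :
    proj c (u ++ v) = proj c u ++ proj c v := by simp [proj]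

theorem proj_cons (c : Fin 2) (x : Letter A) (v : List (Letter A)) :
    proj c (x :: v) = if x.1 = c then x.2 :: proj c v else proj c v := by
  by_cases h : x.1 = c <;> simp [proj, h]

theorem proj_tag (c d : Fin 2) (b : List A) : proj c (tag d b) = if d = c then b else [] := by
  induction b with
  | nil => simp [tag]
  | cons a b ih =>
    have : tag d (a :: b) = (d, a) :: tag d b := rfl
    rw [this, proj_cons, ih]
    by_cases h : d = c <;> simp [h]

@[simp] theorem proj_tag_self (c : Fin 2) (b : List A) : proj c (tag c b) = b := by
  simp [proj_tag]

@[simp] theorem proj_zero_tag_one (b : List A) : proj 0 (tag 1 b) = [] := by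
  simp [proj_tag]

@[simp] theorem proj_one_tag_zero (b : List A) : proj 1 (tag 0 b) = [] := by
  simp [proj_tag]

@[simp] theorem tag_nil (c : Fin 2) : tag c ([] : List A) = [] := rfl

@[simp] theorem tag_cons (c : Fin 2) (a : A) (b : List A) : tag c (a :: b) = (c, a) :: tag c b := rfl

@[simp] theorem tag_append (c : Fin 2) (a b : List A) : tag c (a ++ b) = tag c a ++ tag c b := by
  simp [tag]

theorem exists_eq_tag_of_proj_zero_eq_nil {r : List (Letter A)} (h : proj 0 r = []) :
    ∃ x, r = tag 1 x := by
  induction r with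
  | nil => exact ⟨[], rfl⟩
  | cons l r ih =>
    obtain ⟨c, a⟩ := l
    rw [proj_cons] at h
    fin_cases c
    · simp at h
    · obtain ⟨x, rfl⟩ := ih (by simpa using h)
      exact ⟨a :: x, rfl⟩

theorem exists_eq_tag_append_of_proj_zero_ne_nil {r : List (Letter A)} (h : proj 0 r ≠ []) :
    ∃ x b r', r = tag 1 x ++ (0, b) :: r' := by
  induction r with
  | nil => simp at h
  | cons l r ih =>
    obtain ⟨c, a⟩ := l
    fin_cases c
    · exact ⟨[], a, r, rfl⟩
    · obtain ⟨x, b, r', rfl⟩ := ih (by simpa [proj_cons] using h)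
      exact ⟨a :: x, b, r', rfl⟩

end Words

/-! ### Runs of nondeterministic and of sequential automata -/

section Runs
variable {L Q : Type} (M : NFA L Q)

theorem mem_evalFrom_cons {p q : Q} {l : L} {w : List L} :
    q ∈ M.evalFrom {p} (l :: w) ↔ ∃ r ∈ M.step p l, q ∈ M.evalFrom {r} w := by
  rw [NFA.evalFrom_cons, NFA.stepSet_singleton, NFA.mem_evalFrom_iff_exists]

theorem mem_evalFrom_append {p q : Q} {u v : List L} :
    q ∈ M.evalFrom {p} (u ++ v) ↔ ∃ r ∈ M.evalFrom {p} u, q ∈ M.evalFrom {r} v := by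
  rw [NFA.evalFrom_append, NFA.mem_evalFrom_iff_exists]

theorem mem_evalFrom_concat {p q : Q} {u : List L} {l : L} :
    q ∈ M.evalFrom {p} (u ++ [l]) ↔ ∃ r ∈ M.evalFrom {p} u, q ∈ M.step r l := by
  rw [mem_evalFrom_append]
  simp

theorem mem_accepts_of_start_eq {s : Q} (hs : M.start = {s}) {w : List L} :
    w ∈ M.accepts ↔ ∃ q ∈ M.evalFrom {s} w, q ∈ M.accept := by
  rw [NFA.mem_accepts, hs]
  exact ⟨fun ⟨q, h, h'⟩ => ⟨q, h', h⟩, fun ⟨q, h, h'⟩ => ⟨q, h', h⟩⟩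

end Runs

namespace IsSequential
variable {A Q : Type} {M : NFA (Letter A) Q}

theorem eq_of_mem_evalFrom (hM : IsSequential M) {w : List (Letter A)} :
    ∀ {p q r : Q}, q ∈ M.evalFrom {p} w → r ∈ M.evalFrom {p} w → q = r := by
  induction w with
  | nil => intro p q r h h'; simp at h h'; rw [h, h']
  | cons l w ih =>
    intro p q r h h'
    rw [mem_evalFrom_cons] at h h'
    obtain ⟨s, hs, h⟩ := h
    obtain ⟨s', hs', h'⟩ := h'
    cases hM.deterministic p l hs hs'
    exact ih h h'

theorem notMem_tapeStates_one (hM : IsSequential M) {q : Q} (h : q ∈ tapeStates M 0) :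
    q ∉ tapeStates M 1 := fun h' => Set.disjoint_left.1 hM.partition.disjoint h h'

/-- Where two runs could diverge, an output state offers a single transition, and in an input state
the next letter is dictated by the inputs, which agree there. -/
theorem prefix_or_prefix (hM : IsSequential M) {w : List (Letter A)} :
    ∀ {p q r : Q} {w' : List (Letter A)}, q ∈ M.evalFrom {p} w → r ∈ M.evalFrom {p} w' →
      proj 0 w <+: proj 0 w' → w <+: w' ∨ w' <+: w := by
  induction w with
  | nil => intros; exact Or.inl List.nil_prefix
  | cons l w ih =>
    intro p q r w' h h' hp
    cases w' with
    | nil => exact Or.inr List.nil_prefix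
    | cons l' w' =>
      rw [mem_evalFrom_cons] at h h'
      obtain ⟨s, hs, h⟩ := h
      obtain ⟨s', hs', h'⟩ := h'
      suffices l = l' by
        subst this
        cases hM.deterministic p l hs hs'
        have hp' : proj 0 w <+: proj 0 w' := by
          rw [proj_cons, proj_cons] at hp
          split_ifs at hp with hl
          · exact (List.prefix_cons_inj _).1 hp
          · exact hp
        simpa [List.prefix_cons_inj] using ih h h' hp'
      obtain ⟨c, a⟩ := l
      obtain ⟨c', a'⟩ := l'
      by_cases hc : p ∈ tapeStates M 1
      · exact (hM.output p hc _ _ _ _ hs hs').1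
      · have hc0 : c = 0 := by
          fin_cases c
          · rfl
          · exact absurd ⟨a, s, hs⟩ hc
        have hc0' : c' = 0 := by
          fin_cases c'
          · rfl
          · exact absurd ⟨a', s', hs'⟩ hc
        subst hc0 hc0'
        rw [proj_cons, proj_cons] at hp
        simp only [if_true] at hp
        rw [List.cons_prefix_cons] at hp
        rw [hp.1]

end IsSequential

/-! ### Uniformization as a game -/

section Game
variable {A Z : Type}

/-- The position that is reached from `z` when the word `x` is written on the output tape. -/
def writeOut (δ : Z → Letter A → Z) (z : Z) (x : List A) : Z := (tag 1 x).foldl δ z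

/-- From the position `z` one can answer the question whether the input may end here by some output
`x`, and can continue by the output `y` to a position of `W`. -/
def Good (δ : Z → Letter A → Z) (accD accT : Z → Prop) (W : Set Z) (z : Z) : Prop :=
  ∃ x y : List A, (accD z → accT (writeOut δ z x)) ∧ writeOut δ z (x ++ y) ∈ W

/-- `W` is a set of positions from which the output player wins the uniformization game. -/
def IsWinning (δ : Z → Letter A → Z) (accD accT : Z → Prop) (z₀ : Z) (W : Set Z) : Prop :=
  Good δ accD accT W z₀ ∧ ∀ z ∈ W, ∀ a, Good δ accD accT W (δ z (0, a))

variable {δ : Z → Letter A → Z} {accD accT : Z → Prop} {z₀ : Z} {S T : Language (Letter A)}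

theorem writeOut_foldl (w : List (Letter A)) (x : List A) :
    writeOut δ (w.foldl δ z₀) x = (w ++ tag 1 x).foldl δ z₀ := by
  simp [writeOut]

/-- The output player imitates the automaton. The automaton need not reach an input state once no
longer input is in the domain; such dead words are added to the winning set by hand. -/
theorem exists_isWinning
    (hD : ∀ w : List (Letter A), accD (w.foldl δ z₀) ↔ proj 0 w ∈ (rel S).dom)
    (hT : ∀ w : List (Letter A), accT (w.foldl δ z₀) ↔ w ∈ T ∧ pairOf w ∈ rel S)
    (h : HasControlledUniformization S T) :
    Nonempty A ∧ ∃ W, IsWinning δ accD accT z₀ W := by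
  obtain ⟨U, hUT, ⟨Q, _, M, hM, rfl⟩, hU⟩ := h
  obtain ⟨s, hs⟩ := hM.start
  have hdom : ∀ u, u ∈ (rel S).dom → ∃ w, (∃ q ∈ M.evalFrom {s} w, q ∈ M.accept) ∧ w ∈ T ∧
      pairOf w ∈ rel S ∧ proj 0 w = u := by
    intro u hu
    rw [← hU.dom_eq] at hu
    obtain ⟨v, w, hw, hwp⟩ := hu
    refine ⟨w, (mem_accepts_of_start_eq M hs).1 hw, hUT hw, hU.subset ⟨w, hw, rfl⟩, ?_⟩
    exact congrArg Prod.fst hwp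
  have hneA : Nonempty A := by
    -- The partition condition gives every state an outgoing transition, so a letter exists; this is
    -- why the game carries the condition on the alphabet.
    have : s ∈ tapeStates M 0 ⊔ tapeStates M 1 := by
      rw [hM.partition.sup_eq_top]; trivial
    rcases this with ⟨a, -⟩ | ⟨a, -⟩ <;> exact ⟨a⟩
  refine ⟨hneA, ?_⟩
  let W : Set Z := {z | ∃ w : List (Letter A), w.foldl δ z₀ = z ∧
    ((∃ q ∈ M.evalFrom {s} w, q ∈ tapeStates M 0) ∨
      ∀ u', u' ≠ [] → proj 0 w ++ u' ∉ (rel S).dom)}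
  -- The hypothesis says that `w₁` is forced: every run whose input extends that of `w₁` begins with
  -- `w₁`. The answers to the current input and to longer inputs can thus be read off from accepted
  -- words that continue `w₁`.
  have key : ∀ w₁ : List (Letter A),
      (∀ w q, q ∈ M.evalFrom {s} w → proj 0 w₁ <+: proj 0 w → w₁ <+: w) →
      Good δ accD accT W (w₁.foldl δ z₀) := by
    intro w₁ hw₁
    have hacc : proj 0 w₁ ∈ (rel S).dom → ∃ x, (∃ q, q ∈ M.evalFrom {s} (w₁ ++ tag 1 x)) ∧
        accT (writeOut δ (w₁.foldl δ z₀) x) := by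
      intro hd
      obtain ⟨w, ⟨q, hq, -⟩, hwT, hwS, hwp⟩ := hdom _ hd
      obtain ⟨r, rfl⟩ := hw₁ w q hq (by rw [hwp])
      obtain ⟨x, rfl⟩ := exists_eq_tag_of_proj_zero_eq_nil (r := r) (by simpa using hwp)
      refine ⟨x, ⟨q, hq⟩, ?_⟩
      rw [writeOut_foldl, hT]
      exact ⟨hwT, hwS⟩
    by_cases hdead : ∀ u', u' ≠ [] → proj 0 w₁ ++ u' ∉ (rel S).dom
    · by_cases hd : proj 0 w₁ ∈ (rel S).dom
      · obtain ⟨x, -, hx⟩ := hacc hd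
        refine ⟨x, [], fun _ => hx, w₁ ++ tag 1 x, ?_, Or.inr ?_⟩
        · rw [List.append_nil, writeOut_foldl]
        · simpa using hdead
      · refine ⟨[], [], fun h => absurd ((hD _).1 h) hd, w₁, rfl, Or.inr hdead⟩
    · push Not at hdead
      obtain ⟨u', hu', hd'⟩ := hdead
      obtain ⟨w, ⟨q, hq, -⟩, -, -, hwp⟩ := hdom _ hd'
      obtain ⟨r, rfl⟩ := hw₁ w q hq (by rw [hwp]; exact List.prefix_append _ _)
      obtain ⟨x', b, r', rfl⟩ := exists_eq_tag_append_of_proj_zero_ne_nil (r := r) (by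
        rw [proj_append, List.append_cancel_left_eq] at hwp
        rwa [hwp])
      rw [← List.append_assoc, mem_evalFrom_append] at hq
      obtain ⟨q', hq', hq⟩ := hq
      have hin : q' ∈ tapeStates M 0 := by
        rw [mem_evalFrom_cons] at hq
        obtain ⟨t, ht, -⟩ := hq
        exact ⟨b, t, ht⟩
      by_cases hd : proj 0 w₁ ∈ (rel S).dom
      · obtain ⟨x, ⟨q₂, hq₂⟩, hx⟩ := hacc hd
        -- `x` answers the end of the input, `x'` leads to the next input state. Since no output can
        -- be written in an input state, `x` is a prefix of `x'`, and `y` is the rest.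
        rcases hM.prefix_or_prefix hq₂ hq' (by simp) with hpre | hpre
        · obtain ⟨r₂, hr₂⟩ := hpre
          have : ∃ y, r₂ = tag 1 y := by
            apply exists_eq_tag_of_proj_zero_eq_nil
            simpa using congrArg (proj 0) hr₂
          obtain ⟨y, rfl⟩ := this
          refine ⟨x, y, fun _ => hx, w₁ ++ tag 1 x', ?_, Or.inl ⟨q', hq', hin⟩⟩
          rw [writeOut_foldl, ← hr₂]
          simp
        · obtain ⟨r₂, hr₂⟩ := hpre
          cases r₂ with
          | nil =>
            refine ⟨x, [], fun _ => hx, w₁ ++ tag 1 x', ?_, Or.inl ⟨q', hq', hin⟩⟩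
            rw [writeOut_foldl, List.append_nil, ← hr₂]
            simp
          | cons l r₂ =>
            exfalso
            rw [← hr₂, mem_evalFrom_append] at hq₂
            obtain ⟨q'', hq'', hq₂⟩ := hq₂
            cases hM.eq_of_mem_evalFrom hq' hq''
            rw [mem_evalFrom_cons] at hq₂
            obtain ⟨t, ht, -⟩ := hq₂
            have h0 := congrArg (proj 0) hr₂
            obtain ⟨c, a⟩ := l
            fin_cases c
            · simp [proj_cons] at h0
            · exact hM.notMem_tapeStates_one hin ⟨a, t, ht⟩
      · refine ⟨x', [], fun h => absurd ((hD _).1 h) hd, w₁ ++ tag 1 x', ?_,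
          Or.inl ⟨q', hq', hin⟩⟩
        rw [writeOut_foldl, List.append_nil]
  refine ⟨W, key [] fun w q _ _ => List.nil_prefix, ?_⟩
  rintro z ⟨w, rfl, hw⟩ a
  have hfold : δ (w.foldl δ z₀) (0, a) = (w ++ [(0, a)]).foldl δ z₀ := by simp
  rw [hfold]
  rcases hw with ⟨q, hq, hin⟩ | hw
  · refine key _ fun w' q' hq' hpre => ?_
    have hpre' : proj 0 w <+: proj 0 w' := by
      refine List.IsPrefix.trans ?_ hpre
      simp
    have hww : w <+: w' := by
      rcases hM.prefix_or_prefix hq hq' hpre' with h | ⟨r, rfl⟩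
      · exact h
      · exfalso
        obtain ⟨t, ht⟩ := hpre
        have := congrArg List.length ht
        simp [proj_cons] at this
    obtain ⟨r, rfl⟩ := hww
    have hr : [a] <+: proj 0 r := by
      simpa [proj_cons, List.prefix_append_right_inj] using hpre
    rw [mem_evalFrom_append] at hq'
    obtain ⟨q₂, hq₂, hq'⟩ := hq'
    cases hM.eq_of_mem_evalFrom hq hq₂
    rw [List.prefix_append_right_inj]
    cases r with
    | nil => simp at hr
    | cons l r =>
      obtain ⟨c, b⟩ := l
      rw [mem_evalFrom_cons] at hq'
      obtain ⟨t, ht, -⟩ := hq'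
      fin_cases c
      · rw [proj_cons] at hr
        simp at hr
        subst hr
        exact ⟨r, rfl⟩
      · exact absurd ⟨b, t, ht⟩ (hM.notMem_tapeStates_one hin)
  · refine ⟨[], [], fun h => ?_, w ++ [(0, a)], rfl, Or.inr fun u' _ => ?_⟩
    · rw [hD, proj_append] at h
      exact absurd h (hw _ (by simp [proj_cons]))
    · rw [proj_append, List.append_assoc]
      exact hw _ (by simp [proj_cons])

end Game
end Sync

/-! ### From a winning set to a sequential automaton -/

namespace Sync

section Strategy
variable {A Z : Type} {δ : Z → Letter A → Z} {accD accT : Z → Prop} {z₀ : Z}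
  {S T : Language (Letter A)}

/-- The automaton that plays a positional strategy: after an input letter has led to the position
`z`, it writes the word `x z ++ y z`, accepts after `x z` if `accD z`, and then reads the next input
letter. The number `i` in a state `(z, i)` counts the letters that have been written since. -/
def strategyNFA (δ : Z → Letter A → Z) (accD : Z → Prop) (z₀ : Z) (x y : Z → List A) (N : ℕ) :
    NFA (Letter A) (Z × Fin (N + 1)) where
  step p l := {q | ((x p.1 ++ y p.1)[(p.2 : ℕ)]? = some l.2 ∧ l.1 = 1 ∧ q.1 = p.1 ∧
      (q.2 : ℕ) = p.2 + 1) ∨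
    ((x p.1 ++ y p.1)[(p.2 : ℕ)]? = none ∧ l.1 = 0 ∧
      q.1 = δ (writeOut δ p.1 (x p.1 ++ y p.1)) l ∧ q.2 = 0)}
  start := {(z₀, 0)}
  accept := {p | accD p.1 ∧ (p.2 : ℕ) = (x p.1).length}

variable {x y : Z → List A} {N : ℕ}

theorem isSequential_strategyNFA [Nonempty A] (hN : ∀ z, (x z ++ y z).length ≤ N) :
    IsSequential (strategyNFA δ accD z₀ x y N) := by
  have h0 : ∀ p, p ∈ tapeStates (strategyNFA δ accD z₀ x y N) 0 ↔
      (x p.1 ++ y p.1)[(p.2 : ℕ)]? = none := by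
    intro p
    constructor
    · rintro ⟨a, q, h | h⟩
      · exact absurd h.2.1 (by simp)
      · exact h.1
    · intro h
      obtain ⟨a⟩ := ‹Nonempty A›
      exact ⟨a, (δ (writeOut δ p.1 (x p.1 ++ y p.1)) (0, a), 0), Or.inr ⟨h, rfl, rfl, rfl⟩⟩
  have h1 : ∀ p, p ∈ tapeStates (strategyNFA δ accD z₀ x y N) 1 ↔
      (x p.1 ++ y p.1)[(p.2 : ℕ)]? ≠ none := by
    intro p
    constructor
    · rintro ⟨a, q, h | h⟩
      · rw [h.1]; simp
      · exact absurd h.2.1 (by simp)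
    · intro h
      obtain ⟨a, ha⟩ := Option.ne_none_iff_exists'.1 h
      obtain ⟨hlt, -⟩ := List.getElem?_eq_some_iff.1 ha
      have := hN p.1
      exact ⟨a, (p.1, ⟨p.2 + 1, by omega⟩), Or.inl ⟨ha, rfl, rfl, rfl⟩⟩
  refine ⟨⟨_, rfl⟩, ?_, ?_, ?_⟩
  · rintro p l q (h | h) r (h' | h')
    · exact Prod.ext (h.2.2.1.trans h'.2.2.1.symm) (Fin.ext (h.2.2.2.trans h'.2.2.2.symm))
    · rw [h.1] at h'; simp at h'
    · rw [h.1] at h'; simp at h'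
    · exact Prod.ext (h.2.2.1.trans h'.2.2.1.symm) (h.2.2.2.trans h'.2.2.2.symm)
  · rw [isCompl_comm, ← compl_eq_iff_isCompl]
    ext p
    rw [Set.mem_compl_iff, h0, h1, not_not]
  · intro p hp l l' q r hq hr
    rw [h1] at hp
    rcases hq with h | h
    · rcases hr with h' | h'
      · refine ⟨Prod.ext (h.2.1.trans h'.2.1.symm) ?_, Prod.ext (h.2.2.1.trans h'.2.2.1.symm)
          (Fin.ext (h.2.2.2.trans h'.2.2.2.symm))⟩
        exact Option.some_injective _ (h.1.symm.trans h'.1)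
      · exact absurd h'.1 hp
    · exact absurd h.1 hp

/-- The word that has been processed, and the position that has been reached, when the automaton
`strategyNFA` has just read the reversed input `u`. -/
def play (δ : Z → Letter A → Z) (z₀ : Z) (x y : Z → List A) : List A → List (Letter A) × Z
  | [] => ([], z₀)
  | a :: u =>
    let p := play δ z₀ x y u
    (p.1 ++ tag 1 (x p.2 ++ y p.2) ++ [(0, a)], δ (writeOut δ p.2 (x p.2 ++ y p.2)) (0, a))

theorem proj_play (u : List A) : proj 0 (play δ z₀ x y u).1 = u.reverse := by
  induction u with
  | nil => rfl
  | cons a u ih =>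
    simp only [play, proj_append, ih, List.reverse_cons]
    simp [proj_cons, proj_tag]

theorem play_snd (u : List A) : (play δ z₀ x y u).1.foldl δ z₀ = (play δ z₀ x y u).2 := by
  induction u with
  | nil => rfl
  | cons a u ih =>
    simp only [play, List.foldl_append, ih]
    rfl

/-- The position changes only when an input letter is read, so the input fixes everything except how
much of the current answer has been written. This makes the accepted word unique for each input. -/
theorem mem_evalFrom_strategyNFA {w : List (Letter A)} :
    ∀ {q}, q ∈ (strategyNFA δ accD z₀ x y N).evalFrom {(z₀, 0)} w →
      q.1 = (play δ z₀ x y (proj 0 w).reverse).2 ∧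
      w = (play δ z₀ x y (proj 0 w).reverse).1 ++ tag 1 ((x q.1 ++ y q.1).take q.2) := by
  induction w using List.reverseRecOn with
  | nil =>
    intro q hq
    have hq : q = (z₀, 0) := by simpa using hq
    subst hq
    simp [play]
  | append_singleton w l ih =>
    intro q hq
    rw [mem_evalFrom_concat] at hq
    obtain ⟨p, hp, hq⟩ := hq
    obtain ⟨h1, h2⟩ := ih hp
    obtain ⟨c, a⟩ := l
    rcases hq with ⟨hget, rfl, hq1, hq2⟩ | ⟨hget, rfl, hq1, hq2⟩
    · have : proj 0 (w ++ [((1 : Fin 2), a)]) = proj 0 w := by simp [proj_cons]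
      rw [this, hq1, hq2]
      refine ⟨h1, ?_⟩
      rw [List.take_add_one, hget]
      conv_lhs => rw [h2]
      simp
    · have : proj 0 (w ++ [((0 : Fin 2), a)]) = proj 0 w ++ [a] := by simp [proj_cons]
      rw [this, hq2, List.reverse_append]
      have hlen := List.getElem?_eq_none_iff.1 hget
      rw [List.take_of_length_le hlen] at h2
      simp only [List.reverse_cons, List.reverse_nil, List.nil_append, List.singleton_append, play]
      rw [← h1]
      refine ⟨hq1, ?_⟩
      conv_lhs => rw [h2]
      simp

theorem evalFrom_tag_strategyNFA (hN : ∀ z, (x z ++ y z).length ≤ N) (z : Z) (i : ℕ)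
    (hi : i ≤ (x z ++ y z).length) :
    (z, ⟨i, (hi.trans (hN z)).trans_lt (Nat.lt_succ_self N)⟩) ∈
      (strategyNFA δ accD z₀ x y N).evalFrom {(z, 0)} (tag 1 ((x z ++ y z).take i)) := by
  induction i with
  | zero => simp
  | succ i ih =>
    rw [List.take_add_one, List.getElem?_eq_getElem hi]
    simp only [tag_append, Option.toList_some, tag_cons, tag_nil]
    rw [mem_evalFrom_concat]
    exact ⟨_, ih (Nat.le_of_succ_le hi), Or.inl ⟨List.getElem?_eq_getElem hi, rfl, rfl, rfl⟩⟩

theorem play_mem_evalFrom (hN : ∀ z, (x z ++ y z).length ≤ N) (u : List A) :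
    ((play δ z₀ x y u).2, 0) ∈
      (strategyNFA δ accD z₀ x y N).evalFrom {(z₀, 0)} (play δ z₀ x y u).1 := by
  induction u with
  | nil => simp [play]
  | cons a u ih =>
    simp only [play]
    rw [mem_evalFrom_concat]
    have h := evalFrom_tag_strategyNFA (δ := δ) (accD := accD) (z₀ := z₀) hN
      (play δ z₀ x y u).2 _ le_rfl
    rw [List.take_length] at h
    refine ⟨_, (mem_evalFrom_append _).2 ⟨_, ih, h⟩, Or.inr ⟨?_, rfl, rfl, rfl⟩⟩
    simp

/-- Along the chosen strategy every position reached just after an input letter is good. Acceptance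
only after exactly `x` makes the relation functional; the part `y` is needed only to go on. -/
theorem hasControlledUniformization_of_isWinning [Finite Z] [Nonempty A]
    (hD : ∀ w : List (Letter A), accD (w.foldl δ z₀) ↔ proj 0 w ∈ (rel S).dom)
    (hT : ∀ w : List (Letter A), accT (w.foldl δ z₀) ↔ w ∈ T ∧ pairOf w ∈ rel S)
    {W : Set Z} (hW : IsWinning δ accD accT z₀ W) : HasControlledUniformization S T := by
  have hex : ∀ z, ∃ x y : List A, Good δ accD accT W z →
      (accD z → accT (writeOut δ z x)) ∧ writeOut δ z (x ++ y) ∈ W := by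
    -- The empty words at bad positions are placeholders: these positions are not met.
    intro z
    by_cases h : Good δ accD accT W z
    · obtain ⟨x, y, h'⟩ := h
      exact ⟨x, y, fun _ => h'⟩
    · exact ⟨[], [], fun h' => absurd h' h⟩
  choose x y hxy using hex
  obtain ⟨N, hN⟩ : ∃ N, ∀ z, (x z ++ y z).length ≤ N := by
    obtain ⟨N, hN⟩ := (Set.finite_range fun z => (x z ++ y z).length).bddAbove
    exact ⟨N, fun z => hN ⟨z, rfl⟩⟩
  have hgood : ∀ u, Good δ accD accT W (play δ z₀ x y u).2 := by
    intro u
    induction u with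
    | nil => exact hW.1
    | cons a u ih => exact hW.2 _ (hxy _ ih).2 a
  set M := strategyNFA δ accD z₀ x y N with hM
  have hmem : ∀ w, w ∈ M.accepts ↔ ∃ q ∈ M.evalFrom {(z₀, 0)} w, q ∈ M.accept :=
    fun w => mem_accepts_of_start_eq M rfl
  have hU : ∀ w ∈ M.accepts, accD (play δ z₀ x y (proj 0 w).reverse).2 ∧
      w = (play δ z₀ x y (proj 0 w).reverse).1 ++
        tag 1 (x (play δ z₀ x y (proj 0 w).reverse).2) := by
    intro w hw
    obtain ⟨q, hq, hacc, hlen⟩ := (hmem w).1 hw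
    obtain ⟨h1, h2⟩ := mem_evalFrom_strategyNFA hq
    refine ⟨h1 ▸ hacc, ?_⟩
    rw [← h1]
    rwa [hlen, List.take_left'] at h2
    rfl
  have hUT : ∀ w ∈ M.accepts, w ∈ T ∧ pairOf w ∈ rel S := by
    intro w hw
    obtain ⟨hacc, hw'⟩ := hU w hw
    rw [← hT, hw', ← writeOut_foldl, play_snd]
    exact (hxy _ (hgood _)).1 hacc
  refine ⟨M.accepts, fun w hw => (hUT w hw).1,
    ⟨_, inferInstance, M, isSequential_strategyNFA hN, rfl⟩, ?_, ?_, ?_⟩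
  · rintro _ ⟨w, hw, rfl⟩
    exact (hUT w hw).2
  · ext u
    constructor
    · rintro ⟨v, w, hw, hwp⟩
      exact ⟨v, hwp ▸ (hUT w hw).2⟩
    · intro hu
      set p := play δ z₀ x y u.reverse with hp
      have hpu : proj 0 p.1 = u := by rw [hp, proj_play, List.reverse_reverse]
      have hacc : accD p.2 := by
        rw [hp, ← play_snd, ← hp, hD, hpu]
        exact hu
      refine ⟨proj 1 (p.1 ++ tag 1 (x p.2)), p.1 ++ tag 1 (x p.2), ?_, ?_⟩
      · rw [hmem]
        have h := evalFrom_tag_strategyNFA (δ := δ) (accD := accD) (z₀ := z₀) hN p.2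
          (x p.2).length (by simp)
        rw [List.take_left' rfl] at h
        exact ⟨_, (mem_evalFrom_append _).2 ⟨_, play_mem_evalFrom hN _, h⟩, hacc, rfl⟩
      · simp [pairOf, hpu]
  · rintro u v v' ⟨w, hw, hwp⟩ ⟨w', hw', hwp'⟩
    have h1 : proj 0 w = u := congrArg Prod.fst hwp
    have h1' : proj 0 w' = u := congrArg Prod.fst hwp'
    have h := (hU w hw).2
    have h' := (hU w' hw').2
    rw [h1] at h
    rw [h1', ← h] at h'
    subst h'
    exact congrArg Prod.snd (hwp.symm.trans hwp')

theorem hasControlledUniformization_iff [Finite Z]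
    (hD : ∀ w : List (Letter A), accD (w.foldl δ z₀) ↔ proj 0 w ∈ (rel S).dom)
    (hT : ∀ w : List (Letter A), accT (w.foldl δ z₀) ↔ w ∈ T ∧ pairOf w ∈ rel S) :
    HasControlledUniformization S T ↔ Nonempty A ∧ ∃ W, IsWinning δ accD accT z₀ W :=
  ⟨exists_isWinning hD hT,
    fun ⟨_, _, hW⟩ => hasControlledUniformization_of_isWinning hD hT hW⟩

end Strategy
end Sync

namespace Sync

/-! ### Bit sets -/

theorem exists_testBit_iff (N : ℕ) (p : ℕ → Prop) :
    ∃ C < 2 ^ N, ∀ i < N, C.testBit i = true ↔ p i := by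
  classical
  refine ⟨Nat.ofBits fun i : Fin N => decide (p i), Nat.ofBits_lt_two_pow _, fun i hi => ?_⟩
  rw [Nat.testBit_ofBits_lt _ _ hi]
  simp

theorem eq_of_testBit_iff {N x y : ℕ} (hx : x < 2 ^ N) (hy : y < 2 ^ N)
    (h : ∀ i < N, x.testBit i = true ↔ y.testBit i = true) : x = y := by
  apply Nat.eq_of_testBit_eq
  intro i
  by_cases hi : i < N
  · exact Bool.eq_iff_iff.2 (h i hi)
  · have hle : 2 ^ N ≤ 2 ^ i := Nat.pow_le_pow_right two_pos (not_lt.1 hi)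
    rw [Nat.testBit_lt_two_pow (hx.trans_le hle), Nat.testBit_lt_two_pow (hy.trans_le hle)]

/-- Reachability by steps of `r` between numbers below `N`, expressed by closed sets. -/
def Reach (N : ℕ) (r : ℕ → ℕ → Prop) (x y : ℕ) : Prop :=
  ∀ C < 2 ^ N, C.testBit x = true →
    (∀ s < N, C.testBit s = true → ∀ t < N, r s t → C.testBit t = true) → C.testBit y = true

/-- The set of reachable numbers is itself closed and is coded by some `C < 2 ^ N`. Quantifying over
closed sets instead of paths keeps reachability a bounded statement. -/
theorem reach_iff {N : ℕ} {r : ℕ → ℕ → Prop} {x y : ℕ} (hx : x < N) (hy : y < N) :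
    Reach N r x y ↔ Relation.ReflTransGen (fun s t => s < N ∧ t < N ∧ r s t) x y := by
  constructor
  · intro h
    obtain ⟨C, hC, hCi⟩ := exists_testBit_iff N
      (Relation.ReflTransGen (fun s t => s < N ∧ t < N ∧ r s t) x)
    rw [← hCi y hy]
    refine h C hC ((hCi x hx).2 .refl) fun s hs hsC t ht hr => ?_
    exact (hCi t ht).2 (((hCi s hs).1 hsC).tail ⟨hs, ht, hr⟩)
  · intro h C _ hxC hcl
    induction h with
    | refl => exact hxC
    | tail _ hbc ih => exact hcl _ hbc.1 (ih hbc.1) _ hbc.2.1 hbc.2.2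

/-! ### Automata on numbers -/

/-- An automaton with ε-transitions whose states are the numbers below `B` and whose letters are
annotated numbers below `k`, with acceptance conditions for the domain of the source, for the target
and, by pairs of states, for the source. -/
structure Arena where
  k : ℕ
  B : ℕ
  init : ℕ → Prop
  eps : ℕ → ℕ → Prop
  step : Fin 2 → ℕ → ℕ → ℕ → Prop
  finD : ℕ → Prop
  finT : ℕ → Prop
  finR : ℕ → ℕ → Prop

namespace Arena
variable (Y : Arena)

/-- The state `p` can be reached by a run on the word. -/
inductive Run : List (Letter (Fin Y.k)) → ℕ → Prop
  | init {p : ℕ} : p < Y.B → Y.init p → Run [] p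
  | eps {w : List (Letter (Fin Y.k))} {p q : ℕ} : Run w p → q < Y.B → Y.eps p q → Run w q
  | step {w : List (Letter (Fin Y.k))} {p q : ℕ} (l : Letter (Fin Y.k)) : Run w p → q < Y.B →
      Y.step l.1 l.2 p q → Run (w ++ [l]) q

/-- `z` is the set of states reachable by ε-transitions from a state in `src`. -/
def IsClosure (src : ℕ → Prop) (z : ℕ) : Prop :=
  ∀ q < Y.B, z.testBit q = true ↔ ∃ p < Y.B, src p ∧ Reach Y.B Y.eps p q

/-- `z'` is the set of states that is reached from the set `z` by the letter `(c, a)`. -/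
def IsStep (c : Fin 2) (a z z' : ℕ) : Prop :=
  Y.IsClosure (fun q => ∃ p < Y.B, z.testBit p = true ∧ Y.step c a p q) z'

/-- The set `z` contains a final state for the domain. -/
def AccD (z : ℕ) : Prop := ∃ p < Y.B, z.testBit p = true ∧ Y.finD p

/-- The set `z` contains final states for the target and for the source. -/
def AccT (z : ℕ) : Prop :=
  (∃ p < Y.B, z.testBit p = true ∧ Y.finT p) ∧
    ∃ p < Y.B, z.testBit p = true ∧ ∃ q < Y.B, z.testBit q = true ∧ Y.finR p q

/-- `z'` is reached from `z` by writing one letter. -/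
def OutStep (z z' : ℕ) : Prop := ∃ a < Y.k, Y.IsStep 1 a z z'

/-- The version of `Good` for sets that are given by numbers. -/
def GoodBits (W z : ℕ) : Prop :=
  ∃ z₁ < 2 ^ Y.B, Reach (2 ^ Y.B) Y.OutStep z z₁ ∧ (¬ Y.AccD z ∨ Y.AccT z₁) ∧
    ∃ z₂ < 2 ^ Y.B, Reach (2 ^ Y.B) Y.OutStep z₁ z₂ ∧ W.testBit z₂ = true

/-- The output player wins the uniformization game on the sets of states of `Y`. -/
def Wins : Prop :=
  0 < Y.k ∧ ∃ W < 2 ^ 2 ^ Y.B, (∃ z < 2 ^ Y.B, Y.IsClosure Y.init z ∧ Y.GoodBits W z) ∧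
    ∀ z < 2 ^ Y.B, W.testBit z = true → ∀ a < Y.k, ∀ z' < 2 ^ Y.B, Y.IsStep 0 a z z' →
      Y.GoodBits W z'

/-! ### The subset construction, and the game on bit sets -/

variable {Y}

theorem Run.lt {w : List (Letter (Fin Y.k))} {p : ℕ} (h : Y.Run w p) : p < Y.B := by
  cases h <;> assumption

theorem exists_isClosure (Y : Arena) (src : ℕ → Prop) : ∃ z : Fin (2 ^ Y.B), Y.IsClosure src z := by
  obtain ⟨z, hz, h⟩ := exists_testBit_iff Y.B fun q => ∃ p < Y.B, src p ∧ Reach Y.B Y.eps p q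
  exact ⟨⟨z, hz⟩, h⟩

/-- The number of the set of states reachable by ε-transitions from `src`. -/
noncomputable def closure (Y : Arena) (src : ℕ → Prop) : Fin (2 ^ Y.B) :=
  (exists_isClosure Y src).choose

theorem closure_spec (src : ℕ → Prop) : Y.IsClosure src (Y.closure src) :=
  (exists_isClosure Y src).choose_spec

theorem isClosure_iff {src : ℕ → Prop} {z : ℕ} (hz : z < 2 ^ Y.B) :
    Y.IsClosure src z ↔ z = Y.closure src := by
  constructor
  · intro h
    exact eq_of_testBit_iff hz (Y.closure src).2 fun i hi =>
      (h i hi).trans (closure_spec src i hi).symm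
  · rintro rfl
    exact closure_spec src

/-- The transition function of the subset automaton. -/
noncomputable def next (Y : Arena) (z : Fin (2 ^ Y.B)) (l : Letter (Fin Y.k)) : Fin (2 ^ Y.B) :=
  Y.closure fun q => ∃ p < Y.B, (z : ℕ).testBit p = true ∧ Y.step l.1 l.2 p q

theorem isStep_iff {c : Fin 2} {a : Fin Y.k} {z : Fin (2 ^ Y.B)} {z' : ℕ} (hz' : z' < 2 ^ Y.B) :
    Y.IsStep c a z z' ↔ z' = Y.next z (c, a) :=
  isClosure_iff hz'

theorem testBit_closure_of_src {src : ℕ → Prop} {p : ℕ} (hp : p < Y.B) (h : src p) :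
    (Y.closure src : ℕ).testBit p = true :=
  (closure_spec src p hp).2 ⟨p, hp, h, (reach_iff hp hp).2 .refl⟩

theorem testBit_closure_of_eps {src : ℕ → Prop} {p q : ℕ} (hp : p < Y.B) (hq : q < Y.B)
    (h : (Y.closure src : ℕ).testBit p = true) (hpq : Y.eps p q) :
    (Y.closure src : ℕ).testBit q = true := by
  obtain ⟨s, hs, hsrc, hr⟩ := (closure_spec src p hp).1 h
  refine (closure_spec src q hq).2 ⟨s, hs, hsrc, (reach_iff hs hq).2 ?_⟩
  exact ((reach_iff hs hp).1 hr).tail ⟨hp, hq, hpq⟩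

theorem exists_src_of_testBit_closure {src P : ℕ → Prop} (hsrc : ∀ p < Y.B, src p → P p)
    (heps : ∀ p q, P p → q < Y.B → Y.eps p q → P q) {q : ℕ} (hq : q < Y.B)
    (h : (Y.closure src : ℕ).testBit q = true) : P q := by
  obtain ⟨p, hp, hs, hr⟩ := (closure_spec src q hq).1 h
  rw [reach_iff hp hq] at hr
  clear h hq
  induction hr with
  | refl => exact hsrc _ hp hs
  | tail _ hbc ih => exact heps _ _ ih hbc.2.1 hbc.2.2

/-- Correctness of the subset construction with ε-transitions. All acceptance conditions, including
the one on pairs of states, are read off from the same set of reachable states. -/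
theorem testBit_foldl_next (w : List (Letter (Fin Y.k))) {q : ℕ} (hq : q < Y.B) :
    ((w.foldl Y.next (Y.closure Y.init) : Fin (2 ^ Y.B)) : ℕ).testBit q = true ↔ Y.Run w q := by
  constructor
  · intro h
    induction w using List.reverseRecOn generalizing q with
    | nil =>
      exact exists_src_of_testBit_closure (fun p hp h => Run.init hp h)
        (fun p q hp hq h => Run.eps hp hq h) hq h
    | append_singleton w l ih =>
      rw [List.foldl_append] at h
      refine exists_src_of_testBit_closure ?_ (fun p q hp hq h => Run.eps hp hq h) hq h
      rintro p hp ⟨s, hs, hsz, hst⟩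
      exact Run.step l (ih hs hsz) hp hst
  · intro h
    induction h with
    | init hp h => exact testBit_closure_of_src hp h
    | @eps w p q hp _ h ih =>
      have ih := ih hp.lt
      -- In both cases the set reached is an ε-closure: of the initial states or of the successors
      -- under the last letter.
      rcases List.eq_nil_or_concat' w with rfl | ⟨w, l, rfl⟩
      · exact testBit_closure_of_eps hp.lt hq ih h
      · rw [List.foldl_append] at ih ⊢
        exact testBit_closure_of_eps hp.lt hq ih h
    | step l hp _ h ih =>
      rw [List.foldl_append]
      exact testBit_closure_of_src hq ⟨_, hp.lt, ih hp.lt, h⟩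

theorem accD_foldl (w : List (Letter (Fin Y.k))) :
    Y.AccD (w.foldl Y.next (Y.closure Y.init) : Fin (2 ^ Y.B)) ↔ ∃ p, Y.Run w p ∧ Y.finD p := by
  constructor
  · rintro ⟨p, hp, h, hf⟩
    exact ⟨p, (testBit_foldl_next w hp).1 h, hf⟩
  · rintro ⟨p, h, hf⟩
    exact ⟨p, h.lt, (testBit_foldl_next w h.lt).2 h, hf⟩

theorem accT_foldl (w : List (Letter (Fin Y.k))) :
    Y.AccT (w.foldl Y.next (Y.closure Y.init) : Fin (2 ^ Y.B)) ↔
      (∃ p, Y.Run w p ∧ Y.finT p) ∧ ∃ p q, Y.Run w p ∧ Y.Run w q ∧ Y.finR p q := by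
  constructor
  · rintro ⟨⟨p, hp, h, hf⟩, q, hq, hq', r, hr, hr', hf'⟩
    exact ⟨⟨p, (testBit_foldl_next w hp).1 h, hf⟩, q, r, (testBit_foldl_next w hq).1 hq',
      (testBit_foldl_next w hr).1 hr', hf'⟩
  · rintro ⟨⟨p, h, hf⟩, q, r, hq, hr, hf'⟩
    exact ⟨⟨p, h.lt, (testBit_foldl_next w h.lt).2 h, hf⟩, q, hq.lt,
      (testBit_foldl_next w hq.lt).2 hq, r, hr.lt, (testBit_foldl_next w hr.lt).2 hr, hf'⟩

theorem reach_outStep_iff {z z' : Fin (2 ^ Y.B)} :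
    Reach (2 ^ Y.B) Y.OutStep z z' ↔ ∃ x, writeOut Y.next z x = z' := by
  rw [reach_iff z.2 z'.2]
  constructor
  · intro h
    obtain ⟨z', hz'⟩ := z'
    simp only at h
    induction h with
    | refl => exact ⟨[], rfl⟩
    | @tail b c _ hbc ih =>
      obtain ⟨hb, hc, a, ha, hs⟩ := hbc
      obtain ⟨x, hx⟩ := ih hb
      have := (isStep_iff (a := ⟨a, ha⟩) (z := ⟨b, hb⟩) hc).1 hs
      refine ⟨x ++ [⟨a, ha⟩], ?_⟩
      simp only [writeOut, tag_append, tag_cons, tag_nil, List.foldl_append, List.foldl_cons,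
        List.foldl_nil] at hx ⊢
      rw [hx]
      exact Fin.ext this.symm
  · rintro ⟨x, rfl⟩
    induction x using List.reverseRecOn with
    | nil => exact .refl
    | append_singleton x a ih =>
      refine ih.tail ⟨(writeOut Y.next z x).2, (writeOut Y.next z (x ++ [a])).2, a, a.2, ?_⟩
      rw [isStep_iff (Fin.is_lt _)]
      simp [writeOut]

theorem goodBits_iff {W : ℕ} {z : Fin (2 ^ Y.B)} :
    Y.GoodBits W z ↔ Good Y.next (fun z => Y.AccD z) (fun z => Y.AccT z)
      {z | W.testBit z = true} z := by
  constructor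
  · rintro ⟨z₁, h₁, hr₁, hacc, z₂, h₂, hr₂, hW⟩
    obtain ⟨x, hx⟩ := (reach_outStep_iff (z' := ⟨z₁, h₁⟩)).1 hr₁
    obtain ⟨y, hy⟩ := (reach_outStep_iff (z := ⟨z₁, h₁⟩) (z' := ⟨z₂, h₂⟩)).1 hr₂
    refine ⟨x, y, fun h => ?_, ?_⟩
    · rw [hx]
      exact hacc.resolve_left (not_not_intro h)
    · have : writeOut Y.next z (x ++ y) = ⟨z₂, h₂⟩ := by
        rw [← hy, ← hx]; simp [writeOut]
      rw [this]
      exact hW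
  · rintro ⟨x, y, hacc, hW⟩
    refine ⟨_, Fin.is_lt _, reach_outStep_iff.2 ⟨x, rfl⟩, not_or_of_imp hacc, _, Fin.is_lt _,
      reach_outStep_iff.2 ⟨y, rfl⟩, ?_⟩
    simpa [writeOut] using hW

/-- A winning set of positions is a set of sets of states, hence a number below `2 ^ 2 ^ Y.B`. -/
theorem wins_iff : Y.Wins ↔ Nonempty (Fin Y.k) ∧
    ∃ W, IsWinning Y.next (fun z => Y.AccD z) (fun z => Y.AccT z) (Y.closure Y.init) W := by
  rw [Wins, Fin.pos_iff_nonempty.symm]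
  refine and_congr_right fun _ => ⟨?_, ?_⟩
  · rintro ⟨W, -, ⟨z, hz, hcl, hg⟩, hstep⟩
    rw [isClosure_iff hz] at hcl
    subst hcl
    refine ⟨{z | W.testBit z = true}, goodBits_iff.1 hg, fun z hz a => goodBits_iff.1 ?_⟩
    exact hstep z z.2 hz a a.2 _ (Fin.is_lt _) ((isStep_iff (Fin.is_lt _)).2 rfl)
  · rintro ⟨W, hg, hstep⟩
    obtain ⟨C, hC, hCi⟩ := exists_testBit_iff (2 ^ Y.B) fun z => ∃ h, (⟨z, h⟩ : Fin _) ∈ W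
    have hWC : W = {z : Fin (2 ^ Y.B) | C.testBit z = true} := by
      ext z
      simp [hCi z z.2]
    rw [hWC] at hg hstep
    refine ⟨C, hC, ⟨_, Fin.is_lt _, closure_spec _, goodBits_iff.2 hg⟩, ?_⟩
    intro z hz hzC a ha z' hz' hs
    have := (isStep_iff (a := ⟨a, ha⟩) (z := ⟨z, hz⟩) hz').1 hs
    rw [this]
    exact goodBits_iff.2 (hstep ⟨z, hz⟩ hzC ⟨a, ha⟩)

end Arena
end Sync

/-! ### Closure properties of primitive recursive predicates -/

section PrimrecClosure
variable {α β γ : Type} [Primcodable α] [Primcodable β] [Primcodable γ]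

theorem Primrec.fst_comp {f : α → β × γ} (hf : Primrec f) : Primrec fun x => (f x).1 :=
  Primrec.fst.comp hf

theorem Primrec.snd_comp {f : α → β × γ} (hf : Primrec f) : Primrec fun x => (f x).2 :=
  Primrec.snd.comp hf

theorem Primrec.pow_comp {f g : α → ℕ} (hf : Primrec f) (hg : Primrec g) :
    Primrec fun x => f x ^ g x :=
  (Primrec₂.unpaired'.1 Nat.Primrec.pow).comp hf hg

theorem Primrec.add_comp {f g : α → ℕ} (hf : Primrec f) (hg : Primrec g) :
    Primrec fun x => f x + g x :=
  Primrec.nat_add.comp hf hg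

theorem Primrec.mul_comp {f g : α → ℕ} (hf : Primrec f) (hg : Primrec g) :
    Primrec fun x => f x * g x :=
  Primrec.nat_mul.comp hf hg

theorem Primrec.div_comp {f g : α → ℕ} (hf : Primrec f) (hg : Primrec g) :
    Primrec fun x => f x / g x :=
  Primrec.nat_div.comp hf hg

theorem Primrec.mod_comp {f g : α → ℕ} (hf : Primrec f) (hg : Primrec g) :
    Primrec fun x => f x % g x :=
  Primrec.nat_mod.comp hf hg

theorem Primrec.natPair_comp {f g : α → ℕ} (hf : Primrec f) (hg : Primrec g) :
    Primrec fun x => Nat.pair (f x) (g x) :=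
  Primrec₂.natPair.comp hf hg

theorem Primrec.ofNat_comp {β : Type} [Denumerable β] {f : α → ℕ} (hf : Primrec f) :
    Primrec fun x => Denumerable.ofNat β (f x) :=
  (Primrec.ofNat β).comp hf

attribute [fun_prop] Primrec
attribute [fun_prop] Primrec.id Primrec.const Primrec.comp Primrec.pair Primrec.fst_comp
  Primrec.snd_comp Primrec.pow_comp Primrec.add_comp Primrec.mul_comp Primrec.div_comp
  Primrec.mod_comp Primrec.natPair_comp Primrec.ofNat_comp

namespace PrimrecPred

theorem exists_lt_comp {f : α → ℕ} {p : α → ℕ → Prop} (hf : Primrec f)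
    (hp : PrimrecPred fun x : α × ℕ => p x.1 x.2) : PrimrecPred fun a => ∃ n < f a, p a n := by
  have hp' : PrimrecRel fun (n : ℕ) (a : α) => p a n :=
    hp.comp (f := fun x : ℕ × α => (x.2, x.1)) (by fun_prop)
  exact (hp'.exists_mem_list.comp (Primrec.list_range.comp hf) Primrec.id).of_eq fun a => by simp

theorem forall_lt_comp {f : α → ℕ} {p : α → ℕ → Prop} (hf : Primrec f)
    (hp : PrimrecPred fun x : α × ℕ => p x.1 x.2) : PrimrecPred fun a => ∀ n < f a, p a n :=
  (exists_lt_comp (p := fun a n => ¬ p a n) hf hp.not).not.of_eq fun a => by push Not; rfl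

theorem imp {p q : α → Prop} (hp : PrimrecPred p) (hq : PrimrecPred q) :
    PrimrecPred fun a => p a → q a :=
  (hp.not.or hq).of_eq fun a => by rw [imp_iff_not_or]

theorem iff {p q : α → Prop} (hp : PrimrecPred p) (hq : PrimrecPred q) :
    PrimrecPred fun a => p a ↔ q a :=
  ((hp.imp hq).and (hq.imp hp)).of_eq fun _ => iff_def.symm

theorem eq_comp {f g : α → β} (hf : Primrec f) (hg : Primrec g) : PrimrecPred fun a => f a = g a :=
  Primrec.eq.comp hf hg

theorem lt_comp {f g : α → ℕ} (hf : Primrec f) (hg : Primrec g) : PrimrecPred fun a => f a < g a :=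
  Primrec.nat_lt.comp hf hg

theorem mem_comp {f : α → β} {g : α → List β} (hf : Primrec f) (hg : Primrec g) :
    PrimrecPred fun a => f a ∈ g a :=
  ((Primrec.eq (α := β)).exists_mem_list.comp hg hf).of_eq fun a => by simp

theorem testBit {f g : α → ℕ} (hf : Primrec f) (hg : Primrec g) :
    PrimrecPred fun a => (f a).testBit (g a) = true :=
  (eq_comp (f := fun a => f a / 2 ^ g a % 2) (g := fun _ => 1) (by fun_prop)
    (by fun_prop)).of_eq fun a => by
      rw [Nat.testBit_eq_decide_div_mod_eq, decide_eq_true_iff]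

theorem const (p : Prop) : PrimrecPred fun _ : α => p := by
  by_cases h : p
  · exact (eq_comp (Primrec.const 0) (Primrec.const 0)).of_eq fun _ => by simp [h]
  · exact (eq_comp (Primrec.const 0) (Primrec.const 1)).of_eq fun _ => by simp [h]

end PrimrecPred
end PrimrecClosure

/-! ### Deciding the game by bounded quantification -/

namespace Sync

section
variable {α : Type} [Primcodable α]

open PrimrecPred in
theorem primrecPred_reach {N x y : α → ℕ} {r : α → ℕ → ℕ → Prop} (hN : Primrec N) (hx : Primrec x)
    (hy : Primrec y) (hr : PrimrecPred fun p : α × ℕ × ℕ => r p.1 p.2.1 p.2.2) :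
    PrimrecPred fun a => Reach (N a) (r a) (x a) (y a) := by
  unfold Reach
  refine forall_lt_comp (by fun_prop) (imp (testBit (by fun_prop) (by fun_prop))
    (imp ?_ (testBit (by fun_prop) (by fun_prop))))
  refine forall_lt_comp (by fun_prop) (imp (testBit (by fun_prop) (by fun_prop)) ?_)
  refine forall_lt_comp (by fun_prop) (imp ?_ (testBit (by fun_prop) (by fun_prop)))
  exact hr.comp (f := fun p : ((α × ℕ) × ℕ) × ℕ => (p.1.1.1, p.1.2, p.2)) (by fun_prop)

/-- The arenas `Y a` are primitive recursive, uniformly in `a`. -/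
structure PrimrecArena (Y : α → Arena) : Prop where
  k : Primrec fun a => (Y a).k
  B : Primrec fun a => (Y a).B
  init : PrimrecPred fun p : α × ℕ => (Y p.1).init p.2
  eps : PrimrecPred fun p : α × ℕ × ℕ => (Y p.1).eps p.2.1 p.2.2
  step : ∀ c, PrimrecPred fun p : α × ℕ × ℕ × ℕ => (Y p.1).step c p.2.1 p.2.2.1 p.2.2.2
  finD : PrimrecPred fun p : α × ℕ => (Y p.1).finD p.2
  finT : PrimrecPred fun p : α × ℕ => (Y p.1).finT p.2
  finR : PrimrecPred fun p : α × ℕ × ℕ => (Y p.1).finR p.2.1 p.2.2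

namespace PrimrecArena
variable {Y : α → Arena} (hY : PrimrecArena Y) {β : Type} [Primcodable β]
include hY

open PrimrecPred

theorem isClosure {f : β → α} {src : β → ℕ → Prop} {z : β → ℕ} (hf : Primrec f)
    (hsrc : PrimrecPred fun p : β × ℕ => src p.1 p.2) (hz : Primrec z) :
    PrimrecPred fun b => (Y (f b)).IsClosure (src b) (z b) := by
  have hB := hY.B
  unfold Arena.IsClosure
  refine forall_lt_comp (hB.comp hf) (iff (testBit (by fun_prop) (by fun_prop)) ?_)
  refine exists_lt_comp (hB.comp (by fun_prop)) (PrimrecPred.and ?_ ?_)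
  · exact hsrc.comp (f := fun p : (β × ℕ) × ℕ => (p.1.1, p.2)) (by fun_prop)
  · refine primrecPred_reach (hB.comp (by fun_prop)) (by fun_prop) (by fun_prop) ?_
    exact hY.eps.comp (f := fun p : ((β × ℕ) × ℕ) × ℕ × ℕ => (f p.1.1.1, p.2.1, p.2.2))
      (by fun_prop)

theorem isStep (c : Fin 2) {f : β → α} {a z z' : β → ℕ} (hf : Primrec f) (ha : Primrec a)
    (hz : Primrec z) (hz' : Primrec z') :
    PrimrecPred fun b => (Y (f b)).IsStep c (a b) (z b) (z' b) := by
  unfold Arena.IsStep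
  refine hY.isClosure hf ?_ hz'
  refine exists_lt_comp (hY.B.comp (by fun_prop))
    ((testBit (by fun_prop) (by fun_prop)).and ?_)
  exact (hY.step c).comp (f := fun p : (β × ℕ) × ℕ => (f p.1.1, a p.1.1, p.2, p.1.2))
    (by fun_prop)

theorem accD {f : β → α} {z : β → ℕ} (hf : Primrec f) (hz : Primrec z) :
    PrimrecPred fun b => (Y (f b)).AccD (z b) :=
  exists_lt_comp (hY.B.comp (by fun_prop)) ((testBit (by fun_prop) (by fun_prop)).and
    (hY.finD.comp (f := fun p : β × ℕ => (f p.1, p.2)) (by fun_prop)))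

theorem accT {f : β → α} {z : β → ℕ} (hf : Primrec f) (hz : Primrec z) :
    PrimrecPred fun b => (Y (f b)).AccT (z b) := by
  have hB := hY.B
  refine PrimrecPred.and ?_ ?_
  · exact exists_lt_comp (hB.comp (by fun_prop)) ((testBit (by fun_prop) (by fun_prop)).and
      (hY.finT.comp (f := fun p : β × ℕ => (f p.1, p.2)) (by fun_prop)))
  · refine exists_lt_comp (hB.comp (by fun_prop)) ((testBit (by fun_prop) (by fun_prop)).and ?_)
    refine exists_lt_comp (hB.comp (by fun_prop)) ((testBit (by fun_prop) (by fun_prop)).and ?_)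
    exact hY.finR.comp (f := fun p : (β × ℕ) × ℕ => (f p.1.1, p.1.2, p.2)) (by fun_prop)

theorem reach_outStep {f : β → α} {z z' : β → ℕ} (hf : Primrec f) (hz : Primrec z)
    (hz' : Primrec z') :
    PrimrecPred fun b => Reach (2 ^ (Y (f b)).B) (Y (f b)).OutStep (z b) (z' b) := by
  have hB : Primrec fun b => (Y (f b)).B := hY.B.comp hf
  refine primrecPred_reach (by fun_prop) hz hz' ?_
  exact exists_lt_comp (hY.k.comp (by fun_prop))
    (hY.isStep 1 (by fun_prop) (by fun_prop) (by fun_prop) (by fun_prop))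

theorem goodBits {f : β → α} {W z : β → ℕ} (hf : Primrec f) (hW : Primrec W) (hz : Primrec z) :
    PrimrecPred fun b => (Y (f b)).GoodBits (W b) (z b) := by
  have hB : Primrec fun b => 2 ^ (Y (f b)).B := (Primrec.const 2).pow_comp (hY.B.comp hf)
  unfold Arena.GoodBits
  refine exists_lt_comp hB ((hY.reach_outStep (by fun_prop) (by fun_prop)
    (by fun_prop)).and (((hY.accD (by fun_prop) (by fun_prop)).not.or
      (hY.accT (by fun_prop) (by fun_prop))).and ?_))
  exact exists_lt_comp (hB.comp (by fun_prop)) ((hY.reach_outStep (by fun_prop) (by fun_prop)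
    (by fun_prop)).and (testBit (by fun_prop) (by fun_prop)))

theorem wins : PrimrecPred fun a => (Y a).Wins := by
  have hB : Primrec fun a => 2 ^ (Y a).B := (Primrec.const 2).pow_comp hY.B
  unfold Arena.Wins
  refine (lt_comp (by fun_prop) hY.k).and (exists_lt_comp (by fun_prop) (PrimrecPred.and ?_ ?_))
  · refine exists_lt_comp (hB.comp (by fun_prop)) (PrimrecPred.and ?_
      (hY.goodBits (by fun_prop) (by fun_prop) (by fun_prop)))
    exact hY.isClosure (f := fun p : (α × ℕ) × ℕ => p.1.1) (by fun_prop)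
      (hY.init.comp (f := fun p : ((α × ℕ) × ℕ) × ℕ => (p.1.1.1, p.2)) (by fun_prop))
      (by fun_prop)
  · refine forall_lt_comp (hB.comp (by fun_prop)) (imp (testBit (by fun_prop) (by fun_prop)) ?_)
    refine forall_lt_comp (hY.k.comp (by fun_prop)) (forall_lt_comp (hB.comp (by fun_prop)) (imp ?_ ?_))
    · exact hY.isStep 0 (by fun_prop) (by fun_prop) (by fun_prop) (by fun_prop)
    · exact hY.goodBits (by fun_prop) (by fun_prop) (by fun_prop)

end PrimrecArena
end
end Sync

namespace Sync

/-! ### Paths of coded automata -/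

namespace NFACode
variable (C : NFACode) {k : ℕ}

/-- There is a transition from `p` to `q` labeled by the letter `a` of tape `c`. -/
def Tr (c : Fin 2) (a p q : ℕ) : Prop :=
  p < C.numStates ∧ q < C.numStates ∧ (p, (c, a), q) ∈ C.transitions

/-- There is a path labeled by the word from the first to the second state. -/
def Path : List (Letter (Fin k)) → ℕ → ℕ → Prop
  | [], p, q => p = q
  | l :: w, p, q => ∃ r, C.Tr l.1 l.2 p r ∧ Path w r q

variable {C}

@[simp] theorem path_nil {p q : ℕ} : C.Path ([] : List (Letter (Fin k))) p q ↔ p = q := Iff.rfl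

@[simp] theorem path_cons {l : Letter (Fin k)} {w : List (Letter (Fin k))} {p q : ℕ} :
    C.Path (l :: w) p q ↔ ∃ r, C.Tr l.1 l.2 p r ∧ C.Path w r q := Iff.rfl

theorem path_append {u v : List (Letter (Fin k))} {p q : ℕ} :
    C.Path (u ++ v) p q ↔ ∃ r, C.Path u p r ∧ C.Path v r q := by
  induction u generalizing p with
  | nil => simp
  | cons l u ih =>
    simp only [List.cons_append, path_cons, ih]
    constructor
    · rintro ⟨r, hr, s, hs, hq⟩; exact ⟨s, ⟨r, hr, hs⟩, hq⟩
    · rintro ⟨s, ⟨r, hr, hs⟩, hq⟩; exact ⟨r, hr, s, hs, hq⟩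

theorem path_singleton {l : Letter (Fin k)} {p q : ℕ} :
    C.Path [l] p q ↔ C.Tr l.1 l.2 p q := by simp

theorem Path.append {u v : List (Letter (Fin k))} {p q r : ℕ} (h : C.Path u p q)
    (h' : C.Path v q r) : C.Path (u ++ v) p r := path_append.2 ⟨q, h, h'⟩

theorem Path.lt {w : List (Letter (Fin k))} {p q : ℕ} (h : C.Path w p q) (hp : p < C.numStates) :
    q < C.numStates := by
  induction w generalizing p with
  | nil => exact h ▸ hp
  | cons l w ih =>
    obtain ⟨r, hr, h⟩ := h
    exact ih h hr.2.1

theorem mem_evalFrom_toNFA {w : List (Letter (Fin k))} {p q : Fin C.numStates} :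
    q ∈ (C.toNFA k).evalFrom {p} w ↔ C.Path w p q := by
  induction w generalizing p with
  | nil => simp [Fin.ext_iff, eq_comm]
  | cons l w ih =>
    rw [mem_evalFrom_cons, path_cons]
    constructor
    · rintro ⟨r, hr, h⟩
      exact ⟨r, ⟨p.2, r.2, hr⟩, ih.1 h⟩
    · rintro ⟨r, hr, h⟩
      exact ⟨⟨r, hr.2.1⟩, hr.2.2, ih.2 h⟩

theorem mem_language {w : List (Letter (Fin k))} :
    w ∈ C.language k ↔ C.start < C.numStates ∧ ∃ q, C.Path w C.start q ∧ q ∈ C.final := by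
  rw [language, NFA.mem_accepts]
  constructor
  · rintro ⟨q, hq, h⟩
    rw [NFA.mem_evalFrom_iff_exists] at h
    obtain ⟨p, hp, h⟩ := h
    have hp : (p : ℕ) = C.start := hp
    rw [mem_evalFrom_toNFA, hp] at h
    exact ⟨hp ▸ p.2, q, h, hq⟩
  · rintro ⟨hs, q, h, hq⟩
    refine ⟨⟨q, h.lt hs⟩, hq, ?_⟩
    rw [NFA.mem_evalFrom_iff_exists]
    exact ⟨⟨C.start, hs⟩, rfl, mem_evalFrom_toNFA.2 h⟩

end NFACode

/-! ### Shifts of words -/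

theorem wordShift_cons_cons (a b : Fin 2) (w : List (Fin 2)) :
    wordShift (a :: b :: w) = wordShift (b :: w) + if a ≠ b then 1 else 0 := by
  simp [wordShift, List.countP_cons]

@[simp] theorem wordShift_nil : wordShift [] = 0 := rfl

@[simp] theorem wordShift_singleton (a : Fin 2) : wordShift [a] = 0 := rfl

theorem wordShift_append_cons (u v : List (Fin 2)) (a : Fin 2) :
    wordShift (u ++ a :: v) = wordShift (u ++ [a]) + wordShift (a :: v) := by
  induction u with
  | nil => simp
  | cons b u ih =>
    cases u with
    | nil => simp [wordShift_cons_cons]; omega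
    | cons c u =>
      simp only [List.cons_append, wordShift_cons_cons] at ih ⊢
      omega

theorem wordShift_concat_concat (w : List (Fin 2)) (a b : Fin 2) :
    wordShift (w ++ [a] ++ [b]) = wordShift (w ++ [a]) + if a ≠ b then 1 else 0 := by
  rw [List.append_assoc, List.singleton_append, wordShift_append_cons, wordShift_cons_cons]
  simp

theorem wordShift_concat_le (w : List (Fin 2)) (b : Fin 2) :
    wordShift w ≤ wordShift (w ++ [b]) ∧ wordShift (w ++ [b]) ≤ wordShift w + 1 := by
  rcases List.eq_nil_or_concat' w with rfl | ⟨w, a, rfl⟩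
  · simp
  · rw [wordShift_concat_concat]
    split_ifs <;> omega

theorem wordShift_append (u v : List (Fin 2)) :
    wordShift u + wordShift v ≤ wordShift (u ++ v) ∧
      wordShift (u ++ v) ≤ wordShift u + wordShift v + 1 := by
  cases v with
  | nil => simp
  | cons a v =>
    rw [wordShift_append_cons]
    have := wordShift_concat_le u a
    omega

theorem exists_prefix_wordShift_eq (w : List (Fin 2)) {v : ℕ} (hv : v ≤ wordShift w) :
    ∃ i, wordShift (w.take i) = v := by
  induction w using List.reverseRecOn with
  | nil => exact ⟨0, (Nat.le_zero.1 hv).symm⟩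
  | append_singleton w b ih =>
    have := wordShift_concat_le w b
    by_cases h : v ≤ wordShift w
    · obtain ⟨i, hi⟩ := ih h
      refine ⟨min i w.length, ?_⟩
      rwa [List.take_append_of_le_length (min_le_right _ _), ← List.take_eq_take_min]
    · exact ⟨(w ++ [b]).length, by rw [List.take_length]; omega⟩

theorem le_wordShift_flatten_replicate (y : List (Fin 2)) (hy : 1 ≤ wordShift y) (N : ℕ) :
    N ≤ wordShift (List.replicate N y).flatten := by
  induction N with
  | zero => simp
  | succ N ih =>
    rw [List.replicate_succ, List.flatten_cons]
    have := (wordShift_append y (List.replicate N y).flatten).1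
    omega

/-- If the shift of the language of a code is finite, then it is at most twice the number of states
of the subset automaton. -/
theorem wordShift_lt_of_shift_lt_top {C : NFACode} {k : ℕ} (h : shift (C.language k) < ⊤)
    {w : List (Letter (Fin k))} (hw : w ∈ C.language k) :
    wordShift (w.map Prod.fst) < 2 * 2 ^ C.numStates := by
  by_contra! hlt
  set M := C.toNFA k with hM
  -- Prefixes with an even number of shifts are chosen because a shift may sit on the boundary
  -- between a prefix and the next factor: two extra shifts force at least one inside the factor.
  have hex : ∀ j : Fin (2 ^ C.numStates + 1),
      ∃ i, wordShift ((w.map Prod.fst).take i) = 2 * (j : ℕ) := fun j =>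
    exists_prefix_wordShift_eq _ (by omega)
  choose i hi using hex
  have hninj : ¬ Function.Injective fun j => M.evalFrom M.start (w.take (i j)) := by
    intro hinj
    have := Fintype.card_le_of_injective _ hinj
    rw [Fintype.card_fin, Fintype.card_set, Fintype.card_fin] at this
    omega
  have hpump : ∃ x y z, w = x ++ y ++ z ∧ 1 ≤ wordShift (y.map Prod.fst) ∧
      M.evalFrom M.start (x ++ y) = M.evalFrom M.start x := by
    have haux : ∀ j j', j < j' → M.evalFrom M.start (w.take (i j)) =
        M.evalFrom M.start (w.take (i j')) → ∃ x y z, w = x ++ y ++ z ∧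
          1 ≤ wordShift (y.map Prod.fst) ∧
            M.evalFrom M.start (x ++ y) = M.evalFrom M.start x := by
      intro j j' hjj heq
      have hjj : (j : ℕ) < j' := hjj
      rcases le_total (i j') (i j) with hle | hle
      · exfalso
        obtain ⟨t, ht⟩ := List.take_prefix_take_left (l := w.map Prod.fst) hle
        have := (wordShift_append ((w.map Prod.fst).take (i j')) t).1
        rw [ht, hi, hi] at this
        omega
      · obtain ⟨y, hy⟩ := List.take_prefix_take_left (l := w) hle
        refine ⟨w.take (i j), y, w.drop (i j'), ?_, ?_, ?_⟩
        · rw [hy, List.take_append_drop]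
        · have h1 := (wordShift_append ((w.map Prod.fst).take (i j)) (y.map Prod.fst)).2
          rw [← List.map_take, ← List.map_append, hy, List.map_take, List.map_take, hi, hi] at h1
          omega
        · rw [hy, heq]
    rw [Function.Injective] at hninj
    push Not at hninj
    obtain ⟨j, j', heq, hne⟩ := hninj
    rcases lt_or_gt_of_ne hne with hlt | hlt
    · exact haux j j' hlt heq
    · exact haux j' j hlt heq.symm
  obtain ⟨x, y, z, rfl, hy, hloop⟩ := hpump
  have hN : ∀ N, M.evalFrom M.start (x ++ (List.replicate N y).flatten) =
      M.evalFrom M.start x := by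
    intro N
    induction N with
    | zero => simp
    | succ N ih =>
      rw [List.replicate_succ', List.flatten_append, List.flatten_singleton, ← List.append_assoc,
        NFA.evalFrom_append, ih, ← NFA.evalFrom_append, hloop]
  have hmem : ∀ N, x ++ (List.replicate N y).flatten ++ z ∈ C.language k := by
    intro N
    rw [NFACode.language, NFA.mem_accepts] at hw ⊢
    rw [NFA.evalFrom_append, hloop] at hw
    rw [NFA.evalFrom_append]
    rwa [← hM, hN]
  -- Each copy of `y` contributes a shift, so `N + 1` copies exceed the supremum `N`.
  obtain ⟨N, hN⟩ := ENat.ne_top_iff_exists.1 h.ne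
  have hle : ((wordShift ((x ++ (List.replicate (N + 1) y).flatten ++ z).map Prod.fst) : ℕ) : ℕ∞) ≤
      N := by
    rw [hN]
    exact le_iSup₂_of_le _ (hmem (N + 1)) le_rfl
  rw [Nat.cast_le, List.map_append, List.map_append] at hle
  have h1 := (wordShift_append (x.map Prod.fst ++ (List.replicate (N + 1) y).flatten.map Prod.fst)
    (z.map Prod.fst)).1
  have h2 := (wordShift_append (x.map Prod.fst)
    ((List.replicate (N + 1) y).flatten.map Prod.fst)).1
  have h3 := le_wordShift_flatten_replicate _ hy (N + 1)
  rw [List.map_flatten, List.map_replicate] at h1 h2 hle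
  omega

/-! ### Decompositions of paths into blocks -/

section Blocks
variable {C : NFACode} {k : ℕ}

/-- The word `u` labels on tape `c` a sequence of `m + 1` paths, where the `j`-th path leads from
`σ (2 * j + c)` to `σ (2 * j + 1 + c)`, except for the last one, which ends in `q`. -/
def TapeRun (C : NFACode) (c : Fin 2) (σ : ℕ → ℕ) : ℕ → List (Fin k) → ℕ → Prop
  | 0, u, q => C.Path (tag c u) (σ c) q
  | m + 1, u, q => ∃ u₁ u₂, u = u₁ ++ u₂ ∧ TapeRun C c σ m u₁ (σ (2 * m + 1 + c)) ∧
      C.Path (tag c u₂) (σ (2 * m + 2 + c)) q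

theorem TapeRun.append {c : Fin 2} {σ : ℕ → ℕ} {m : ℕ} {u v : List (Fin k)} {q r : ℕ}
    (h : TapeRun C c σ m u q) (h' : C.Path (tag c v) q r) : TapeRun C c σ m (u ++ v) r := by
  cases m with
  | zero =>
    rw [TapeRun, tag_append]
    exact NFACode.Path.append h h'
  | succ m =>
    obtain ⟨u₁, u₂, rfl, h₁, h₂⟩ := h
    refine ⟨u₁, u₂ ++ v, by simp, h₁, ?_⟩
    rw [tag_append]
    exact h₂.append h'

/-- Input block `j` ends in `σ (2 * j + 1)`, where output block `j` starts, and output block `j`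
ends where input block `j + 1` starts. Hence independent runs on the two tapes with the same `σ` can
be interleaved. -/
theorem TapeRun.exists_path {σ : ℕ → ℕ} {m : ℕ} {u v : List (Fin k)} {q : ℕ}
    (h₀ : TapeRun C 0 σ m u (σ (2 * m + 1))) (h₁ : TapeRun C 1 σ m v q) :
    ∃ w, C.Path w (σ 0) q ∧ proj 0 w = u ∧ proj 1 w = v := by
  induction m generalizing u v q with
  | zero => exact ⟨tag 0 u ++ tag 1 v, NFACode.Path.append h₀ h₁, by simp, by simp⟩
  | succ m ih =>
    obtain ⟨u₁, u₂, rfl, hu₁, hu₂⟩ := h₀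
    obtain ⟨v₁, v₂, rfl, hv₁, hv₂⟩ := h₁
    obtain ⟨w, hw, rfl, rfl⟩ := ih hu₁ hv₁
    exact ⟨w ++ tag 0 u₂ ++ tag 1 v₂, (hw.append hu₂).append hv₂, by simp, by simp⟩

/-- The parity of `i` as a tape. -/
def parity (i : ℕ) : Fin 2 := if i % 2 = 0 then 0 else 1

/-- The word labels a path from `σ 0` to the last state, that is composed of blocks `0, …, i` on
alternating tapes, where the block `j` begins in the state `σ j`. -/
def BlockPath (C : NFACode) (σ : ℕ → ℕ) : ℕ → List (Letter (Fin k)) → ℕ → Prop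
  | 0, w, q => ∃ b, w = tag (parity 0) b ∧ C.Path w (σ 0) q
  | i + 1, w, q => ∃ w₁ b, w = w₁ ++ tag (parity (i + 1)) b ∧ BlockPath C σ i w₁ (σ (i + 1)) ∧
      C.Path (tag (parity (i + 1)) b) (σ (i + 1)) q

theorem BlockPath.congr {σ τ : ℕ → ℕ} {i : ℕ} {w : List (Letter (Fin k))} {q : ℕ}
    (h : BlockPath C σ i w q) (hστ : ∀ j ≤ i, σ j = τ j) : BlockPath C τ i w q := by
  induction i generalizing w q with
  | zero =>
    obtain ⟨b, rfl, h⟩ := h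
    exact ⟨b, rfl, hστ 0 le_rfl ▸ h⟩
  | succ i ih =>
    obtain ⟨w₁, b, rfl, h₁, h₂⟩ := h
    rw [hστ (i + 1) le_rfl] at h₁ h₂
    exact ⟨w₁, b, rfl, ih h₁ fun j hj => hστ j (hj.trans i.le_succ), h₂⟩

theorem BlockPath.append {σ : ℕ → ℕ} {i : ℕ} {w : List (Letter (Fin k))} {q r : ℕ}
    {b : List (Fin k)} (h : BlockPath C σ i w q) (h' : C.Path (tag (parity i) b) q r) :
    BlockPath C σ i (w ++ tag (parity i) b) r := by
  cases i with
  | zero =>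
    obtain ⟨b', rfl, h⟩ := h
    exact ⟨b' ++ b, by simp, h.append h'⟩
  | succ i =>
    obtain ⟨w₁, b', rfl, h₁, h₂⟩ := h
    refine ⟨w₁, b' ++ b, by simp, h₁, ?_⟩
    rw [tag_append]
    exact h₂.append h'

theorem BlockPath.succ {σ : ℕ → ℕ} {i : ℕ} {w : List (Letter (Fin k))} {q r : ℕ}
    {b : List (Fin k)} (h : BlockPath C σ i w q) (h' : C.Path (tag (parity (i + 1)) b) q r) :
    BlockPath C (Function.update σ (i + 1) q) (i + 1) (w ++ tag (parity (i + 1)) b) r := by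
  refine ⟨w, b, rfl, ?_, ?_⟩
  · rw [Function.update_self]
    exact h.congr fun j hj => (Function.update_of_ne (by omega) _ _).symm
  · rwa [Function.update_self]

/-- Padding by empty blocks lets a single number of blocks serve for all words. -/
theorem BlockPath.exists_of_le {σ : ℕ → ℕ} {i N : ℕ} {w : List (Letter (Fin k))} {q : ℕ}
    (h : BlockPath C σ i w q) (hσ : ∀ j, σ j < C.numStates) (hq : q < C.numStates) (hi : i ≤ N) :
    ∃ τ : ℕ → ℕ, (∀ j, τ j < C.numStates) ∧ τ 0 = σ 0 ∧ BlockPath C τ N w q := by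
  induction N, hi using Nat.le_induction with
  | base => exact ⟨σ, hσ, rfl, h⟩
  | succ N _ ih =>
    obtain ⟨τ, hτ, h0, h⟩ := ih
    refine ⟨Function.update τ (N + 1) q, fun j => ?_, ?_, ?_⟩
    · by_cases hj : j = N + 1
      · rw [hj, Function.update_self]; exact hq
      · rw [Function.update_of_ne hj]; exact hτ j
    · rw [Function.update_of_ne (by omega), h0]
    · simpa using h.succ (b := []) (r := q) (by simp)

theorem parity_succ_of_ne {i : ℕ} {c : Fin 2} (h : c ≠ parity i) : c = parity (i + 1) := by
  unfold parity at *
  rcases Nat.mod_two_eq_zero_or_one i with h' | h'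
  · rw [if_pos h'] at h
    rw [if_neg (by omega)]
    omega
  · rw [if_neg (by omega)] at h
    rw [if_pos (by omega)]
    omega

theorem exists_blockPath {w : List (Letter (Fin k))} {s t : ℕ} (hs : s < C.numStates)
    (h : C.Path w s t) : ∃ σ i, i ≤ wordShift (w.map Prod.fst) + 1 ∧ (∀ j, σ j < C.numStates) ∧
      σ 0 = s ∧ BlockPath C σ i w t := by
  -- The induction must know the tape of the last letter, to see that a new block costs a shift. The
  -- exception is a word that starts with output: its block `0` is empty, which explains the `+ 1`.
  suffices ∃ σ i, i ≤ wordShift (w.map Prod.fst) + 1 ∧ (∀ j, σ j < C.numStates) ∧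
      σ 0 = s ∧ BlockPath C σ i w t ∧ (w = [] → i = 0) ∧
        ∀ w' l, w = w' ++ [l] → l.1 = parity i by
    obtain ⟨σ, i, h1, h2, h3, h4, -⟩ := this
    exact ⟨σ, i, h1, h2, h3, h4⟩
  induction w using List.reverseRecOn generalizing t with
  | nil =>
    refine ⟨fun _ => s, 0, by simp, fun _ => hs, rfl, ⟨[], rfl, h⟩, fun _ => rfl, ?_⟩
    intro w' l hw
    simp at hw
  | append_singleton w l ih =>
    obtain ⟨r, hr, hl⟩ := NFACode.path_append.1 h
    obtain ⟨σ, i, hi, hσ, h0, hb, hnil, hlast⟩ := ih hr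
    obtain ⟨c, a⟩ := l
    by_cases hc : c = parity i
    · subst hc
      refine ⟨σ, i, ?_, hσ, h0, hb.append (b := [a]) hl, fun h => by simp at h, ?_⟩
      · have := (wordShift_concat_le (w.map Prod.fst) (parity i)).1
        rw [List.map_append]
        exact hi.trans (Nat.succ_le_succ this)
      · intro w' l hw
        rw [← (List.append_singleton_inj.1 hw).2]
    · obtain rfl := parity_succ_of_ne hc
      refine ⟨Function.update σ (i + 1) r, i + 1, ?_, fun j => ?_, ?_, hb.succ (b := [a]) hl,
        fun h => by simp at h, ?_⟩
      · rcases List.eq_nil_or_concat' w with rfl | ⟨w', l', rfl⟩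
        · simp [hnil]
        · have := wordShift_concat_concat (w'.map Prod.fst) l'.1 (parity (i + 1))
          rw [if_pos] at this
          · simp only [List.map_append, List.map_cons, List.map_nil] at hi ⊢
            omega
          · rw [hlast _ _ rfl]
            exact fun h => hc h.symm
      · by_cases hj : j = i + 1
        · rw [hj, Function.update_self]; exact hr.lt hs
        · rw [Function.update_of_ne hj]; exact hσ j
      · rw [Function.update_of_ne (by omega), h0]
      · intro w' l hw
        rw [← (List.append_singleton_inj.1 hw).2]

theorem BlockPath.tapeRun {σ : ℕ → ℕ} {m : ℕ} {w : List (Letter (Fin k))} {q : ℕ}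
    (h : BlockPath C σ (2 * m + 1) w q) :
    TapeRun C 0 σ m (proj 0 w) (σ (2 * m + 1)) ∧ TapeRun C 1 σ m (proj 1 w) q := by
  induction m generalizing w q with
  | zero =>
    obtain ⟨w₁, b, rfl, ⟨b', rfl, h₁⟩, h₂⟩ := h
    simp only [parity] at *
    simp at *
    exact ⟨h₁, h₂⟩
  | succ m ih =>
    have h : BlockPath C σ (2 * m + 1 + 1 + 1) w q := h
    obtain ⟨w₁, b, rfl, ⟨w₂, b', rfl, h₁, h₂⟩, h₃⟩ := h
    obtain ⟨h0, h1⟩ := ih h₁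
    have e0 : parity (2 * m + 1 + 1) = 0 := by unfold parity; rw [if_pos (by omega)]
    have e1 : parity (2 * m + 1 + 1 + 1) = 1 := by unfold parity; rw [if_neg (by omega)]
    rw [e1] at h₃ ⊢
    rw [e0] at h₂ ⊢
    refine ⟨⟨proj 0 w₂, b', by simp, h0, h₂⟩, ⟨proj 1 w₂, b, by simp, h1, h₃⟩⟩

end Blocks
end Sync

namespace Sync

/-! ### Sequences of states as numbers -/

/-- The `j`-th digit of `s` in base `n`. -/
def digit (n s j : ℕ) : ℕ := s / n ^ j % n

theorem exists_digit_eq {n : ℕ} (σ : ℕ → ℕ) (hσ : ∀ j, σ j < n) (N : ℕ) :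
    ∃ s < n ^ N, ∀ j < N, digit n s j = σ j := by
  have hn : 0 < n := (Nat.zero_le _).trans_lt (hσ 0)
  induction N with
  | zero => exact ⟨0, by simp, by simp⟩
  | succ N ih =>
    obtain ⟨s, hs, h⟩ := ih
    refine ⟨s + n ^ N * σ N, ?_, fun j hj => ?_⟩
    · have : n ^ N * (σ N + 1) ≤ n ^ N * n := Nat.mul_le_mul_left _ (hσ N)
      rw [pow_succ]
      linarith
    · rcases Nat.lt_succ_iff_lt_or_eq.1 hj with hj | rfl
      · rw [← h j hj]
        obtain ⟨d, rfl⟩ := Nat.exists_eq_add_of_lt hj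
        -- The new leading term is a multiple of `n ^ (j + 1)` and leaves digit `j` unchanged.
        have : n ^ (j + d + 1) * σ (j + d + 1) = n ^ j * (n * (n ^ d * σ (j + d + 1))) := by ring
        rw [digit, digit, this, Nat.add_mul_div_left _ _ (pow_pos hn j), Nat.add_mul_mod_self_left]
      · rw [digit, Nat.add_mul_div_left _ _ (pow_pos hn j), Nat.div_eq_of_lt hs, zero_add,
          Nat.mod_eq_of_lt (hσ j)]

/-! ### The arena of the uniformization problem -/

/-- States of the arena: a tag that selects a component, a number that codes a sequence of states of
the source automaton, the index of a block, and a state of an automaton. -/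
abbrev Node : Type := ℕ × ℕ × ℕ × ℕ

/-- The node with a given number. -/
def node (p : ℕ) : Node := Denumerable.ofNat Node p

@[simp] theorem node_encode (x : Node) : node (Encodable.encode x) = x :=
  Denumerable.ofNat_encode x

@[simp] theorem encode_node (p : ℕ) : Encodable.encode (node p) = p :=
  Denumerable.encode_ofNat p

/-- The initial nodes. -/
def nodeInit (S T : NFACode) (x : Node) : Prop :=
  (x.1 = 0 ∧ x.2.2.1 = 0 ∧ S.start < S.numStates ∧ x.2.2.2 = S.start ∧
      digit S.numStates x.2.1 0 = S.start) ∨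
    (x.1 = 1 ∧ x.2.2.1 = 0 ∧ x.2.2.2 = digit S.numStates x.2.1 1) ∨
    (x.1 = 2 ∧ S.start < S.numStates ∧ x.2.2.2 = S.start) ∨
    (x.1 = 3 ∧ T.start < T.numStates ∧ x.2.2.2 = T.start)

/-- The ε-transitions: a jump to the next block of the same tape (tags `0`, `1`), or a guessed output
letter of the source (tag `2`). -/
def nodeEps (k : ℕ) (S : NFACode) (x y : Node) : Prop :=
  y.1 = x.1 ∧ y.2.1 = x.2.1 ∧
    ((x.1 < 2 ∧ y.2.2.1 = x.2.2.1 + 1 ∧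
        x.2.2.2 = digit S.numStates x.2.1 (2 * x.2.2.1 + 1 + x.1) ∧
        y.2.2.2 = digit S.numStates x.2.1 (2 * x.2.2.1 + 2 + x.1)) ∨
      (x.1 = 2 ∧ y.2.2.1 = x.2.2.1 ∧ ∃ a < k, S.Tr 1 a x.2.2.2 y.2.2.2))

/-- The transitions labeled by `(c, a)`. -/
def nodeStep (S T : NFACode) (c : Fin 2) (a : ℕ) (x y : Node) : Prop :=
  y.1 = x.1 ∧ y.2.1 = x.2.1 ∧ y.2.2.1 = x.2.2.1 ∧
    ((x.1 < 2 ∧ x.1 = c ∧ S.Tr c a x.2.2.2 y.2.2.2) ∨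
      (x.1 < 2 ∧ x.1 ≠ c ∧ y.2.2.2 = x.2.2.2) ∨
      (x.1 = 2 ∧ c = 0 ∧ S.Tr 0 a x.2.2.2 y.2.2.2) ∨
      (x.1 = 2 ∧ c = 1 ∧ y.2.2.2 = x.2.2.2) ∨
      (x.1 = 3 ∧ T.Tr c a x.2.2.2 y.2.2.2))

/-- The final pairs of nodes for the source. -/
def nodeFin (S : NFACode) (x y : Node) : Prop :=
  x.1 = 0 ∧ y.1 = 1 ∧ x.2.1 = y.2.1 ∧ x.2.2.1 = y.2.2.1 ∧
    x.2.2.2 = digit S.numStates x.2.1 (2 * x.2.2.1 + 1) ∧ y.2.2.2 ∈ S.final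

/-- A bound for the numbers of the relevant nodes. -/
def nodeBound (S T : NFACode) : ℕ :=
  Nat.pair 3 (Nat.pair (S.numStates ^ (2 * 2 ^ S.numStates + 3))
    (Nat.pair (2 ^ S.numStates) (S.numStates + T.numStates))) + 1

/-- The arena of the uniformization problem for the source `S` and the target `T`. -/
def arena (k : ℕ) (S T : NFACode) : Arena where
  k := k
  B := nodeBound S T
  init p := nodeInit S T (node p)
  eps p q := nodeEps k S (node p) (node q)
  step c a p q := nodeStep S T c a (node p) (node q)
  finD p := (node p).1 = 2 ∧ (node p).2.2.2 ∈ S.final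
  finT p := (node p).1 = 3 ∧ (node p).2.2.2 ∈ T.final
  finR p q := nodeFin S (node p) (node q)

/-! ### Correctness of the components of the arena -/

section Runs
variable {k : ℕ} {S T : NFACode}

theorem natPair_le_natPair {a b c d : ℕ} (h : a ≤ c) (h' : b ≤ d) : Nat.pair a b ≤ Nat.pair c d := by
  have h₁ : Nat.pair a b ≤ Nat.pair c b := by
    rcases h.lt_or_eq with h | rfl
    · exact (Nat.pair_lt_pair_left b h).le
    · exact le_rfl
  have h₂ : Nat.pair c b ≤ Nat.pair c d := by
    rcases h'.lt_or_eq with h' | rfl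
    · exact (Nat.pair_lt_pair_right c h').le
    · exact le_rfl
  exact h₁.trans h₂

/-- A run of the arena that leads to a node. -/
def NodeRun (k : ℕ) (S T : NFACode) (w : List (Letter (Fin k))) (x : Node) : Prop :=
  (arena k S T).Run w (Encodable.encode x)

/-- Only this direction is needed. Other nodes below the bound do no harm, since soundness of the
runs is proved for all nodes. -/
theorem encode_lt_nodeBound {t s m q : ℕ} (ht : t ≤ 3)
    (hs : s ≤ S.numStates ^ (2 * 2 ^ S.numStates + 3)) (hm : m ≤ 2 ^ S.numStates)
    (hq : q ≤ S.numStates + T.numStates) :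
    Encodable.encode ((t, s, m, q) : Node) < nodeBound S T := by
  rw [nodeBound, Nat.lt_succ_iff]
  exact natPair_le_natPair ht (natPair_le_natPair hs (natPair_le_natPair hm hq))

theorem NodeRun.init {x : Node} (hx : Encodable.encode x < nodeBound S T) (h : nodeInit S T x) :
    NodeRun k S T [] x :=
  Arena.Run.init hx (by simpa only [arena, node_encode] using h)

theorem NodeRun.eps {w : List (Letter (Fin k))} {x y : Node} (h : NodeRun k S T w x)
    (hy : Encodable.encode y < nodeBound S T) (hxy : nodeEps k S x y) : NodeRun k S T w y :=
  Arena.Run.eps h hy (by simpa only [arena, node_encode] using hxy)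

theorem NodeRun.step {w : List (Letter (Fin k))} {x y : Node} (h : NodeRun k S T w x)
    (hy : Encodable.encode y < nodeBound S T) (l : Letter (Fin k))
    (hxy : nodeStep S T l.1 l.2 x y) : NodeRun k S T (w ++ [l]) y :=
  Arena.Run.step (Y := arena k S T) l h hy (by simpa only [arena, node_encode] using hxy)

theorem run_iff_nodeRun {w : List (Letter (Fin k))} {p : ℕ} :
    (arena k S T).Run w p ↔ NodeRun k S T w (node p) := by
  rw [NodeRun, encode_node]

theorem NodeRun.induction {P : List (Letter (Fin k)) → Node → Prop}
    (hinit : ∀ x, nodeInit S T x → P [] x)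
    (heps : ∀ w x y, P w x → nodeEps k S x y → P w y)
    (hstep : ∀ w x y (l : Letter (Fin k)), P w x → nodeStep S T l.1 l.2 x y → P (w ++ [l]) y)
    {w : List (Letter (Fin k))} {x : Node} (h : NodeRun k S T w x) : P w x := by
  suffices ∀ (w : List (Letter (Fin (arena k S T).k))) p, (arena k S T).Run w p → P w (node p) by
    simpa only [node_encode] using this w _ h
  intro w p hp
  induction hp with
  | init _ h => exact hinit _ h
  | eps _ _ h ih => exact heps _ _ _ ih h
  | step l _ _ h ih => exact hstep _ _ _ l ih h

theorem exists_run_finT {w : List (Letter (Fin k))} :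
    (∃ p, (arena k S T).Run w p ∧ (arena k S T).finT p) ↔ w ∈ T.language k := by
  constructor
  · rintro ⟨p, hr, h3, hf⟩
    rw [run_iff_nodeRun] at hr
    have := NodeRun.induction (P := fun w x => x.1 = 3 → T.start < T.numStates ∧
      T.Path w T.start x.2.2.2) ?_ ?_ ?_ hr h3
    · exact NFACode.mem_language.2 ⟨this.1, _, this.2, hf⟩
    · rintro ⟨t, s, m, q⟩ h rfl
      simp [nodeInit] at h
      exact ⟨h.1, h.2.symm⟩
    · rintro w ⟨t, s, m, q⟩ ⟨t', s', m', q'⟩ - h rfl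
      simp only [nodeEps] at h
      omega
    · rintro w ⟨t, s, m, q⟩ ⟨t', s', m', q'⟩ l ih h rfl
      simp only [nodeStep] at h
      obtain ⟨rfl, rfl, rfl, h⟩ := h
      have h : T.Tr l.1 l.2 q q' := by simpa using h
      exact ⟨(ih rfl).1, (ih rfl).2.append (NFACode.path_singleton.2 h)⟩
  · intro hw
    obtain ⟨hs, q, hq, hf⟩ := NFACode.mem_language.1 hw
    refine ⟨Encodable.encode ((3, 0, 0, q) : Node), ?_, by simpa only [arena, node_encode, true_and] using hf⟩
    clear hw hf
    change NodeRun k S T w (3, 0, 0, q)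
    induction w using List.reverseRecOn generalizing q with
    | nil =>
      cases hq
      exact NodeRun.init (encode_lt_nodeBound le_rfl (Nat.zero_le _) (Nat.zero_le _) (by omega))
        (by simpa [nodeInit] using hs)
    | append_singleton w l ih =>
      have hlt := hq.lt hs
      obtain ⟨r, hr, h⟩ := NFACode.path_append.1 hq
      rw [NFACode.path_singleton] at h
      exact NodeRun.step (ih r hr)
        (encode_lt_nodeBound le_rfl (Nat.zero_le _) (Nat.zero_le _) (by omega)) l
        (by simpa [nodeStep] using h)

/-- The component with tag `2` ignores the output letters of `w` and guesses those of a source word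
with the same input by ε-transitions. -/
theorem exists_run_finD {w : List (Letter (Fin k))} :
    (∃ p, (arena k S T).Run w p ∧ (arena k S T).finD p) ↔
      proj 0 w ∈ (rel (S.language k)).dom := by
  constructor
  · rintro ⟨p, hr, h2, hf⟩
    rw [run_iff_nodeRun] at hr
    have := NodeRun.induction (P := fun w x => x.1 = 2 → S.start < S.numStates ∧
      ∃ w', proj 0 w' = proj 0 w ∧ S.Path w' S.start x.2.2.2) ?_ ?_ ?_ hr h2
    · obtain ⟨hs, w', hp, hw'⟩ := this
      exact ⟨proj 1 w', w', NFACode.mem_language.2 ⟨hs, _, hw', hf⟩, by rw [pairOf, hp]⟩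
    · rintro ⟨t, s, m, q⟩ h rfl
      simp [nodeInit] at h
      exact ⟨h.1, [], rfl, h.2.symm⟩
    · rintro w ⟨t, s, m, q⟩ ⟨t', s', m', q'⟩ ih h rfl
      simp only [nodeEps] at h
      obtain ⟨rfl, rfl, ⟨h, -⟩ | ⟨-, rfl, a, ha, h⟩⟩ := h
      · omega
      · obtain ⟨hs, w', hp, hw'⟩ := ih rfl
        exact ⟨hs, w' ++ [(1, ⟨a, ha⟩)], by simp [hp, proj_cons],
          hw'.append (NFACode.path_singleton.2 h)⟩
    · rintro w ⟨t, s, m, q⟩ ⟨t', s', m', q'⟩ ⟨c, a⟩ ih h rfl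
      simp only [nodeStep] at h
      obtain ⟨rfl, rfl, rfl, h⟩ := h
      obtain ⟨hs, w', hp, hw'⟩ := ih rfl
      fin_cases c
      · have h : S.Tr 0 a q q' := by simpa using h
        exact ⟨hs, w' ++ [(0, a)], by simp [hp, proj_cons],
          hw'.append (NFACode.path_singleton.2 h)⟩
      · have h : q' = q := by simpa using h
        subst h
        exact ⟨hs, w', by simp [hp, proj_cons], hw'⟩
  · rintro ⟨v, w', hw', hpair⟩
    have hp : proj 0 w' = proj 0 w := congrArg Prod.fst hpair
    clear hpair
    obtain ⟨hs, q, hq, hf⟩ := NFACode.mem_language.1 hw'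
    refine ⟨Encodable.encode ((2, 0, 0, q) : Node), ?_, by simpa only [arena, node_encode, true_and] using hf⟩
    clear hw' hf
    change NodeRun k S T w (2, 0, 0, q)
    have hB : ∀ {r}, r < S.numStates → Encodable.encode ((2, 0, 0, r) : Node) < nodeBound S T :=
      fun hr => encode_lt_nodeBound (by norm_num) (Nat.zero_le _) (Nat.zero_le _) (by omega)
    induction w using List.reverseRecOn generalizing q w' with
    | nil =>
      obtain ⟨x, rfl⟩ := exists_eq_tag_of_proj_zero_eq_nil (r := w') hp
      clear hp
      induction x using List.reverseRecOn generalizing q with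
      | nil =>
        cases hq
        exact NodeRun.init (hB hs) (by simpa [nodeInit] using hs)
      | append_singleton x a ih =>
        have hlt := hq.lt hs
        rw [tag_append] at hq
        obtain ⟨r, hr, h⟩ := NFACode.path_append.1 hq
        exact NodeRun.eps (ih r hr) (hB hlt)
          (by simpa [nodeEps] using ⟨a, a.2, NFACode.path_singleton.1 h⟩)
    | append_singleton w l ih =>
      obtain ⟨c, a⟩ := l
      fin_cases c
      -- Trailing output letters of `w'` are peeled off as ε-transitions until its last input letter
      -- meets that of `w`.
      · induction w' using List.reverseRecOn generalizing q with
        | nil => simp [proj_cons] at hp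
        | append_singleton w' l' ih' =>
          obtain ⟨c', a'⟩ := l'
          have hlt := hq.lt hs
          obtain ⟨r, hr, h⟩ := NFACode.path_append.1 hq
          rw [NFACode.path_singleton] at h
          fin_cases c'
          · simp only [proj_append, proj_cons, proj_nil, Fin.zero_eta, if_true,
              List.append_singleton_inj] at hp
            obtain ⟨hp, rfl⟩ := hp
            exact NodeRun.step (ih w' hp r hr) (hB hlt) _ (by simpa [nodeStep] using h)
          · refine NodeRun.eps (ih' r hr (by simpa [proj_cons] using hp)) (hB hlt) ?_
            simpa [nodeEps] using ⟨a', a'.2, h⟩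
      · exact NodeRun.step (ih w' (by simpa [proj_cons] using hp) q hq) (hB (hq.lt hs)) _
          (by simp [nodeStep])

/-- The components with tags `0` and `1` each read one tape and never change the guess `x.2.1`. The
start state is checked on tape `0` only; the other tape inherits it through the common guess. -/
theorem NodeRun.tapeRun (c : Fin 2) {w : List (Letter (Fin k))} {x : Node}
    (h : NodeRun k S T w x) (hc : x.1 = c) :
    TapeRun S c (digit S.numStates x.2.1) x.2.2.1 (proj c w) x.2.2.2 ∧
      (c = 0 → S.start < S.numStates ∧ digit S.numStates x.2.1 0 = S.start) := by
  have hc2 := c.2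
  revert hc
  refine NodeRun.induction (P := fun w x => x.1 = c →
    TapeRun S c (digit S.numStates x.2.1) x.2.2.1 (proj c w) x.2.2.2 ∧
      (c = 0 → S.start < S.numStates ∧ digit S.numStates x.2.1 0 = S.start)) ?_ ?_ ?_ h
  · rintro ⟨t, s, m, q⟩ h hc
    simp only [nodeInit] at h
    simp only at hc
    subst hc
    fin_cases c
    · simp at h
      obtain ⟨rfl, h, rfl, h'⟩ := h
      exact ⟨h', fun _ => ⟨h, h'⟩⟩
    · simp at h
      obtain ⟨rfl, h⟩ := h
      exact ⟨h.symm, fun h => by simp at h⟩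
  · rintro w ⟨t, s, m, q⟩ ⟨t', s', m', q'⟩ ih h hc
    simp only at hc
    subst hc
    simp only [nodeEps] at h
    obtain ⟨rfl, rfl, ⟨-, rfl, hq, hq'⟩ | ⟨h, -⟩⟩ := h
    · obtain ⟨h1, h2⟩ := ih rfl
      refine ⟨⟨_, [], (List.append_nil _).symm, ?_, hq'.symm⟩, h2⟩
      simpa only [← hq] using h1
    · omega
  · rintro w ⟨t, s, m, q⟩ ⟨t', s', m', q'⟩ ⟨d, a⟩ ih h hc
    simp only at hc
    subst hc
    simp only [nodeStep] at h
    obtain ⟨rfl, rfl, rfl, h⟩ := h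
    obtain ⟨h1, h2⟩ := ih rfl
    refine ⟨?_, h2⟩
    rcases h with ⟨-, h, htr⟩ | ⟨-, h, rfl⟩ | ⟨h, -⟩ | ⟨h, -⟩ | ⟨h, -⟩
    · obtain rfl := Fin.ext h
      rw [proj_append, proj_cons, if_pos rfl]
      exact h1.append (v := [a]) (NFACode.path_singleton.2 htr)
    · have : proj c (w ++ [(d, a)]) = proj c w := by
        rw [proj_append, proj_cons, if_neg (fun h' => h (congrArg Fin.val h'.symm))]
        simp
      rw [this]
      exact h1
    all_goals omega

/-- Induction on `w` and, inside it, on the number of blocks: an empty last block is entered by a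
jump, a nonempty one ends with the last letter of the tape. -/
theorem NodeRun.of_tapeRun (c : Fin 2) {s : ℕ} (hn : S.start < S.numStates)
    (hs : s < S.numStates ^ (2 * 2 ^ S.numStates + 3))
    (h0 : c = 0 → digit S.numStates s 0 = S.start) {w : List (Letter (Fin k))} :
    ∀ m q : ℕ, m ≤ 2 ^ S.numStates → TapeRun S c (digit S.numStates s) m (proj c w) q →
      NodeRun k S T w (c, s, m, q) := by
  have hc2 := c.2
  have hd : ∀ j, digit S.numStates s j < S.numStates := fun j =>
    Nat.mod_lt _ ((Nat.zero_le _).trans_lt hn)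
  have hB : ∀ {m q}, m ≤ 2 ^ S.numStates → q < S.numStates →
      Encodable.encode ((c, s, m, q) : Node) < nodeBound S T := fun hm hq =>
    encode_lt_nodeBound (by omega) hs.le hm (by omega)
  have jump : ∀ {w : List (Letter (Fin k))} {m}, m + 1 ≤ 2 ^ S.numStates →
      NodeRun k S T w (c, s, m, digit S.numStates s (2 * m + 1 + c)) →
      NodeRun k S T w (c, s, m + 1, digit S.numStates s (2 * m + 2 + c)) := by
    intro w m hm h
    exact h.eps (hB hm (hd _)) ⟨rfl, rfl, Or.inl ⟨hc2, rfl, rfl, rfl⟩⟩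
  induction w using List.reverseRecOn with
  | nil =>
    intro m
    induction m with
    | zero =>
      intro q hm h
      have h : digit S.numStates s c = q := h
      subst h
      refine NodeRun.init (hB hm (hd _)) ?_
      fin_cases c
      · have := h0 rfl
        simp [nodeInit, this, hn]
      · simp [nodeInit]
    | succ m ih =>
      rintro q hm ⟨u₁, u₂, hu, h₁, h₂⟩
      obtain ⟨rfl, rfl⟩ := List.append_eq_nil_iff.1 hu.symm
      cases h₂
      exact jump hm (ih _ (by omega) h₁)
  | append_singleton w l ihw =>
    obtain ⟨d, a⟩ := l
    by_cases hdc : d = c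
    · subst hdc
      have hpr : proj d (w ++ [(d, a)]) = proj d w ++ [a] := by simp [proj_cons]
      rw [hpr]
      have hstep : ∀ {m r q}, m ≤ 2 ^ S.numStates →
          TapeRun S d (digit S.numStates s) m (proj d w) r → S.Tr d a r q →
          NodeRun k S T (w ++ [(d, a)]) (d, s, m, q) := fun hm h htr =>
        (ihw _ _ hm h).step (hB hm htr.2.1) (d, a) ⟨rfl, rfl, rfl, Or.inl ⟨hc2, rfl, htr⟩⟩
      intro m
      induction m with
      | zero =>
        intro q hm h
        rw [TapeRun, tag_append] at h
        obtain ⟨r, hr, h⟩ := NFACode.path_append.1 h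
        exact hstep hm hr (NFACode.path_singleton.1 h)
      | succ m ih =>
        rintro q hm ⟨u₁, u₂, hu, h₁, h₂⟩
        rcases List.eq_nil_or_concat' u₂ with rfl | ⟨u₂, b, rfl⟩
        · rw [List.append_nil] at hu
          subst hu
          cases h₂
          exact jump hm (ih _ (by omega) h₁)
        · rw [← List.append_assoc, List.append_singleton_inj] at hu
          obtain ⟨hu, rfl⟩ := hu
          rw [tag_append] at h₂
          obtain ⟨r, hr, h₂⟩ := NFACode.path_append.1 h₂
          exact hstep hm ⟨u₁, u₂, hu, h₁, hr⟩ (NFACode.path_singleton.1 h₂)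
    · have hpr : proj c (w ++ [(d, a)]) = proj c w := by simp [proj_cons, hdc]
      rw [hpr]
      intro m q hm h
      have hr := ihw m q hm h
      have hq : Encodable.encode ((c, s, m, q) : Node) < nodeBound S T := hr.lt
      refine hr.step hq (d, a) ⟨rfl, rfl, rfl, Or.inr (Or.inl ⟨hc2, ?_, rfl⟩)⟩
      exact fun h => hdc (Fin.ext h.symm)

/-- Soundness interleaves the two tape runs. Completeness is where finite shift enters: it bounds
the number of blocks, so that the boundary states fit into one number. -/
theorem exists_run_finR (hS : shift (S.language k) < ⊤) {w : List (Letter (Fin k))} :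
    (∃ p q, (arena k S T).Run w p ∧ (arena k S T).Run w q ∧ (arena k S T).finR p q) ↔
      pairOf w ∈ rel (S.language k) := by
  constructor
  · rintro ⟨p, q, hp, hq, hx, hy, hs, hm, hx', hf⟩
    rw [run_iff_nodeRun] at hp hq
    obtain ⟨h0, hst⟩ := hp.tapeRun 0 hx
    obtain ⟨h1, -⟩ := hq.tapeRun 1 hy
    rw [hx'] at h0
    rw [← hs, ← hm] at h1
    obtain ⟨w', hw', e0, e1⟩ := h0.exists_path h1
    rw [(hst rfl).2] at hw'
    exact ⟨w', NFACode.mem_language.2 ⟨(hst rfl).1, _, hw', hf⟩, by rw [pairOf, pairOf, e0, e1]⟩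
  · rintro ⟨w', hw', hp⟩
    have hshift := wordShift_lt_of_shift_lt_top hS hw'
    obtain ⟨hst, q, hq, hf⟩ := NFACode.mem_language.1 hw'
    obtain ⟨σ, i, hi, hσ, h0, hb⟩ := exists_blockPath hst hq
    obtain ⟨τ, hτ, hτ0, hb⟩ := hb.exists_of_le hσ (hq.lt hst)
      -- This makes `m = 2 ^ S.numStates` on both tapes; the boundary states used have indices up to
      -- `2 * m + 1`.
      (show i ≤ 2 * 2 ^ S.numStates + 1 by omega)
    obtain ⟨s, hs, hdig⟩ := exists_digit_eq τ hτ (2 * 2 ^ S.numStates + 3)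
    have hb := (hb.congr (τ := digit S.numStates s)
      fun j hj => (hdig j (by omega)).symm).tapeRun
    rw [show proj 0 w' = proj 0 w from congrArg Prod.fst hp,
      show proj 1 w' = proj 1 w from congrArg Prod.snd hp] at hb
    have hstart : digit S.numStates s 0 = S.start := by rw [hdig 0 (by omega), hτ0, h0]
    refine ⟨_, _, NodeRun.of_tapeRun 0 hst hs (fun _ => hstart) _ _ le_rfl hb.1,
      NodeRun.of_tapeRun 1 hst hs (fun h => by simp at h) _ _ le_rfl hb.2, ?_⟩
    simp only [arena, node_encode]
    exact ⟨rfl, rfl, rfl, rfl, rfl, hf⟩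

theorem wins_arena_iff (hS : shift (S.language k) < ⊤) :
    (arena k S T).Wins ↔ HasControlledUniformization (S.language k) (T.language k) := by
  rw [Arena.wins_iff]
  symm
  exact hasControlledUniformization_iff
    (fun w => (Arena.accD_foldl (Y := arena k S T) w).trans exists_run_finD)
    (fun w => (Arena.accT_foldl (Y := arena k S T) w).trans
      (and_congr exists_run_finT (exists_run_finR hS)))

end Runs
end Sync

namespace Sync

/-! ### Computability of the arena -/

section
variable {α : Type} [Primcodable α]

theorem primrec_numStates {f : α → NFACode} (hf : Primrec f) :
    Primrec fun x => (f x).numStates :=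
  (Primrec.fst.comp (Primrec.of_equiv (e := NFACode.equivTuple))).comp hf

theorem primrec_start {f : α → NFACode} (hf : Primrec f) : Primrec fun x => (f x).start :=
  (Primrec.fst.comp (Primrec.snd.comp (Primrec.of_equiv (e := NFACode.equivTuple)))).comp hf

theorem primrec_transitions {f : α → NFACode} (hf : Primrec f) :
    Primrec fun x => (f x).transitions :=
  (Primrec.fst.comp (Primrec.snd.comp (Primrec.snd.comp
    (Primrec.of_equiv (e := NFACode.equivTuple))))).comp hf

theorem primrec_final {f : α → NFACode} (hf : Primrec f) : Primrec fun x => (f x).final :=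
  (Primrec.snd.comp (Primrec.snd.comp (Primrec.snd.comp
    (Primrec.of_equiv (e := NFACode.equivTuple))))).comp hf

theorem primrec_node {f : α → ℕ} (hf : Primrec f) : Primrec fun x => node (f x) :=
  Primrec.ofNat_comp hf

theorem primrec_digit {f g h : α → ℕ} (hf : Primrec f) (hg : Primrec g) (hh : Primrec h) :
    Primrec fun x => digit (f x) (g x) (h x) := by
  unfold digit
  fun_prop

attribute [fun_prop] primrec_numStates primrec_start primrec_transitions primrec_final primrec_node
  primrec_digit

theorem primrecPred_tr (c : Fin 2) {C : α → NFACode} {a p q : α → ℕ} (hC : Primrec C)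
    (ha : Primrec a) (hp : Primrec p) (hq : Primrec q) :
    PrimrecPred fun x => (C x).Tr c (a x) (p x) (q x) :=
  (PrimrecPred.lt_comp (by fun_prop) (by fun_prop)).and
    ((PrimrecPred.lt_comp (by fun_prop) (by fun_prop)).and
      (PrimrecPred.mem_comp (f := fun x => (p x, ((c, a x) : Letter ℕ), q x)) (by fun_prop)
        (by fun_prop)))

end

open PrimrecPred in
theorem primrecArena_arena :
    PrimrecArena fun x : ℕ × NFACode × NFACode => arena x.1 x.2.1 x.2.2 where
  k := Primrec.fst
  B := by
    simp only [arena, nodeBound]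
    fun_prop
  init := by
    simp only [arena, nodeInit]
    refine PrimrecPred.or ?_ (PrimrecPred.or ?_ (PrimrecPred.or ?_ ?_))
    · exact (eq_comp (by fun_prop) (by fun_prop)).and ((eq_comp (by fun_prop) (by fun_prop)).and
        ((lt_comp (by fun_prop) (by fun_prop)).and ((eq_comp (by fun_prop) (by fun_prop)).and
          (eq_comp (by fun_prop) (by fun_prop)))))
    · exact (eq_comp (by fun_prop) (by fun_prop)).and ((eq_comp (by fun_prop) (by fun_prop)).and
        (eq_comp (by fun_prop) (by fun_prop)))
    · exact (eq_comp (by fun_prop) (by fun_prop)).and ((lt_comp (by fun_prop) (by fun_prop)).and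
        (eq_comp (by fun_prop) (by fun_prop)))
    · exact (eq_comp (by fun_prop) (by fun_prop)).and ((lt_comp (by fun_prop) (by fun_prop)).and
        (eq_comp (by fun_prop) (by fun_prop)))
  eps := by
    simp only [arena, nodeEps]
    refine (eq_comp (by fun_prop) (by fun_prop)).and ((eq_comp (by fun_prop) (by fun_prop)).and
      (PrimrecPred.or ?_ ?_))
    · exact (lt_comp (by fun_prop) (by fun_prop)).and ((eq_comp (by fun_prop) (by fun_prop)).and
        ((eq_comp (by fun_prop) (by fun_prop)).and (eq_comp (by fun_prop) (by fun_prop))))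
    · exact (eq_comp (by fun_prop) (by fun_prop)).and ((eq_comp (by fun_prop) (by fun_prop)).and
        (exists_lt_comp (by fun_prop)
          (primrecPred_tr 1 (by fun_prop) (by fun_prop) (by fun_prop) (by fun_prop))))
  step c := by
    simp only [arena, nodeStep]
    refine (eq_comp (by fun_prop) (by fun_prop)).and ((eq_comp (by fun_prop) (by fun_prop)).and
      ((eq_comp (by fun_prop) (by fun_prop)).and
        (PrimrecPred.or ?_ (PrimrecPred.or ?_ (PrimrecPred.or ?_ (PrimrecPred.or ?_ ?_))))))
    · exact (lt_comp (by fun_prop) (by fun_prop)).and ((eq_comp (by fun_prop) (by fun_prop)).and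
        (primrecPred_tr c (by fun_prop) (by fun_prop) (by fun_prop) (by fun_prop)))
    · exact (lt_comp (by fun_prop) (by fun_prop)).and
        ((eq_comp (by fun_prop) (by fun_prop)).not.and (eq_comp (by fun_prop) (by fun_prop)))
    · exact (eq_comp (by fun_prop) (by fun_prop)).and ((PrimrecPred.const _).and
        (primrecPred_tr 0 (by fun_prop) (by fun_prop) (by fun_prop) (by fun_prop)))
    · exact (eq_comp (by fun_prop) (by fun_prop)).and ((PrimrecPred.const _).and
        (eq_comp (by fun_prop) (by fun_prop)))
    · exact (eq_comp (by fun_prop) (by fun_prop)).and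
        (primrecPred_tr c (by fun_prop) (by fun_prop) (by fun_prop) (by fun_prop))
  finD := (eq_comp (by fun_prop) (by fun_prop)).and (mem_comp (by fun_prop) (by fun_prop))
  finT := (eq_comp (by fun_prop) (by fun_prop)).and (mem_comp (by fun_prop) (by fun_prop))
  finR := (eq_comp (by fun_prop) (by fun_prop)).and ((eq_comp (by fun_prop) (by fun_prop)).and
    ((eq_comp (by fun_prop) (by fun_prop)).and ((eq_comp (by fun_prop) (by fun_prop)).and
      ((eq_comp (by fun_prop) (by fun_prop)).and (mem_comp (by fun_prop) (by fun_prop))))))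

end Sync

theorem mainTheorem3 :
    ∃ decider : ℕ × Sync.NFACode × Sync.NFACode → Bool, Computable decider ∧
      ∀ (k : ℕ) (S T : Sync.NFACode), Sync.shift (S.language k) < ⊤ →
        (decider (k, S, T) = true ↔
          Sync.HasControlledUniformization (S.language k) (T.language k)) := by
  classical
  -- The decider evaluates `Arena.Wins` and halts on all codes; finite shift is needed only for the
  -- meaning of its answer.
  refine ⟨_, Sync.primrecArena_arena.wins.decide.to_comp, fun k S T hS => ?_⟩
  rw [decide_eq_true_iff]
  exact Sync.wins_arena_iff hS
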